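/- **Theorem (sublinear convergence of adaptive central finite-difference methods).** Let $d,N\ge 1$, let $\zeta$ be a random variable with law $P$, and let $F(x)=\mathbb{E}_\zeta[f(x,\zeta)]$ for $x\in\mathbb{R}^d$, where $f(x,\cdot)$ is $P$-integrable for every $x$. Assume: * $F$ is twice continuously differentiable and $F^*:=\inf_x F(x)>-\infty$; for every $\zeta$ the function $f(\cdot,\zeta)$ is twice continuously differentiable with $L_f$-Lipschitz gradient and $M_f$-Lipschitz Hessian (operator norm); * for some $\beta_1,\beta_2\ge 0$, $\mathbb{E}_\zeta\|\nabla f(x,\zeta)-\nabla F(x)\|^2\le\beta_1\|\nabla F(x)\|^2+\beta_2$ for all $x$. Then $F$ itself has $L_f$-Lipschitz gradient and $M_f$-Lipschitz Hessian. Let $L_F>0$ and $M_F$ be any Lipschitz constants of $\nabla F$ and $\nabla^2F$. Let $\nu,\theta>0$. For a finite sample $S$ put $F_S=\frac1{|S|}\sum_{\zeta_i\in S}f(\cdot,\zeta_i)$, and for directions $T=(u_1,\dots,u_N)$ put $$g_{S,T}(x)=\gamma\sum_{j=1}^N\frac{F_S(x+\nu u_j)-F_S(x-\nu u_j)}{2\nu}\,u_j,\qquad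 g_T(x)=\mathbb{E}_S[g_{S,T}(x)],$$ and write $g_{\zeta,T}$ for $g_{\{\zeta\},T}$. The methods are: * cFD: $N=d$, $T=(e_1,\dots,e_d)$, $\gamma=1$; * cGS: $u_j$ i.i.d. $\mathcal N(0,I)$, $\gamma=1/N$; * cSS: $u_j$ i.i.d. uniform on the unit sphere, $\gamma=d/N$; * cRC: $N\le d$, $T$ consists of $N$ canonical vectors drawn uniformly without replacement, $\gamma=d/N$; * cRS: $N\le d$, $T$ consists of $N$ vectors drawn uniformly without replacement from a random orthonormal basis of $\mathbb{R}^d$ (of any distribution), $\gamma=d/N$. With $\Omega_1=\frac1{4(1+\theta^2)L_F}$ and $\Omega_2=\frac{dM_F^2\nu^4}{48}$, set $$\begin{array}{c|c|c} & \bar\alpha & \bar\chi\\\hline \text{cFD} & \Omega_1 & \Omega_2\\ \text{cGS} & \frac{N}{N+4.5d}\Omega_1 & \frac{72Nd+216d^2+(d+2)(d+4)(d+6)}{2(N+4.5d)}\Omega_2\\ \text{cSS} & \frac{N}{N+4.5d}\Omega_1 & \frac{72N+216d+d^2}{2d(N+4.5d)}\Omega_2\\ \text{cRC},\ \text{cRS}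 & \frac Nd\Omega_1 & \Omega_2 \end{array}$$ Fix one of the five methods and a deterministic $x_0\in\mathbb{R}^d$, and let $x_{k+1}=x_k-\bar\alpha\,g_{S_k,T_k}(x_k)$ for $k\ge0$. Here, at step $k$, given the past $\mathcal F_k$, directions $T_k$ and i.i.d. samples of $\zeta$ are drawn, independently of each other and jointly independent of $\mathcal F_k$; $T_k$ has the law of the method, and $S_k$ consists of $|S_k|\ge1$ of these samples, where $|S_k|$ is $\mathcal F_k$-measurable and almost surely satisfies, for every $k$, the theoretical norm condition $$\frac{\mathbb{E}_{T_k}\big[\mathbb{E}_{\zeta}\|g_{\zeta,T_k}(x_k)-g_{T_k}(x_k)\|^2\big]}{|S_k|}\le\theta^2\,\mathbb{E}_{T_k}\|g_{T_k}(x_k)\|^2$$ (the expectations over $T_k$ and $\zeta$ are taken with $x_k$ held fixed). Then $\mathbb{E}\|\nabla F(x_k)\|^2<\infty$ for all $k$, and for every $K\ge1$ $$\min_{0\le k\le K-1}\mathbb{E}\|\nabla F(x_k)\|^2\le\frac{4(F(x_0)-F^*)}{K\bar\alpha}+4\bar\chi .$$ Moreover, for every $p\in(0,1]$, with probability at least $1-p$,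 $$\min_{0\le k\le K-1}\|\nabla F(x_k)\|^2\le\frac{4(F(x_0)-F^*)}{K\bar\alpha p}+\frac{4\bar\chi}{p}.$$ -/

import Mathlib

open MeasureTheory ProbabilityTheory

/-! ### The stochastic optimization problem -/

/-- Euclidean space `ℝ^d` with the `ℓ₂` norm. -/
abbrev Vec (d : ℕ) : Type := EuclideanSpace ℝ (Fin d)

/-- The objective `F(x) = E_ζ[f(x, ζ)]`, with `ζ` of law `P`. -/
noncomputable def objective {d : ℕ} {Ξ : Type*} [MeasurableSpace Ξ] (P : Measure Ξ)
    (f : Vec d → Ξ → ℝ) (x : Vec d) : ℝ :=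
  ∫ ζ, f x ζ ∂P

/-- `φ` has an `L`-Lipschitz gradient and (in operator norm) an `M`-Lipschitz Hessian. -/
def HasLipschitzGradHess {d : ℕ} (φ : Vec d → ℝ) (L M : ℝ) : Prop :=
  (∀ x y, ‖gradient φ x - gradient φ y‖ ≤ L * ‖x - y‖) ∧
  (∀ x y, ‖fderiv ℝ (gradient φ) x - fderiv ℝ (gradient φ) y‖ ≤ M * ‖x - y‖)

/-- Smoothness assumption: `f(x, ·)` is an integrable random variable, so that `F` is well
defined; `F` is `C²` and bounded below; every `f(·, ζ)` is `C²` with `Lf`-Lipschitz gradient and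
`Mf`-Lipschitz Hessian. -/
structure SmoothAssumption {d : ℕ} {Ξ : Type*} [MeasurableSpace Ξ] (P : Measure Ξ)
    (f : Vec d → Ξ → ℝ) (Lf Mf : ℝ) : Prop where
  measurable : ∀ x, Measurable (f x)
  integrable : ∀ x, Integrable (f x) P
  contDiff_objective : ContDiff ℝ 2 (objective P f)
  bddBelow : BddBelow (Set.range (objective P f))
  contDiff : ∀ ζ, ContDiff ℝ 2 (fun x => f x ζ)
  lipschitz : ∀ ζ, HasLipschitzGradHess (fun x => f x ζ) Lf Mf

/-- Bounded variance of the stochastic gradients. -/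
structure BoundedGradVariance {d : ℕ} {Ξ : Type*} [MeasurableSpace Ξ] (P : Measure Ξ)
    (f : Vec d → Ξ → ℝ) (β₁ β₂ : ℝ) : Prop where
  nonneg₁ : 0 ≤ β₁
  nonneg₂ : 0 ≤ β₂
  integrable : ∀ x, Integrable
    (fun ζ => ‖gradient (fun y => f y ζ) x - gradient (objective P f) x‖ ^ 2) P
  bound : ∀ x, ∫ ζ, ‖gradient (fun y => f y ζ) x - gradient (objective P f) x‖ ^ 2 ∂P
    ≤ β₁ * ‖gradient (objective P f) x‖ ^ 2 + β₂

/-! ### Central finite-difference gradient estimators -/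

/-- The subsampled function `F_S(x) = (1/|S|) ∑_{ζ ∈ S} f(x, ζ)`. -/
noncomputable def sampleAverage {d : ℕ} {Ξ : Type*} (f : Vec d → Ξ → ℝ) {n : ℕ}
    (s : Fin n → Ξ) (x : Vec d) : ℝ :=
  (1 / (n : ℝ)) * ∑ i, f x (s i)

/-- Central finite differences of `φ` at `x` along the directions `u`, with sampling radius `ν` and
scaling `γ`: `γ ∑_j ((φ(x + ν u_j) - φ(x - ν u_j)) / (2ν)) u_j`. -/
noncomputable def centralFD {d N : ℕ} (γ ν : ℝ) (φ : Vec d → ℝ) (u : Fin N → Vec d)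
    (x : Vec d) : Vec d :=
  γ • ∑ j, ((φ (x + ν • u j) - φ (x - ν • u j)) / (2 * ν)) • u j

/-- The estimator `g_{S,T}(x)`. -/
noncomputable def gST {d N : ℕ} {Ξ : Type*} (f : Vec d → Ξ → ℝ) (γ ν : ℝ) {n : ℕ}
    (s : Fin n → Ξ) (u : Fin N → Vec d) (x : Vec d) : Vec d :=
  centralFD γ ν (sampleAverage f s) u x

/-- `g_T(x) = E_S[g_{S,T}(x)]`, where `S` consists of `n` i.i.d. samples of law `P`. -/
noncomputable def gT {d N : ℕ} {Ξ : Type*} [MeasurableSpace Ξ] (P : Measure Ξ)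
    (f : Vec d → Ξ → ℝ) (γ ν : ℝ) (n : ℕ) (u : Fin N → Vec d) (x : Vec d) : Vec d :=
  ∫ s : Fin n → Ξ, gST f γ ν s u x ∂(Measure.pi fun _ => P)

/-- The theoretical norm condition at the point `x` for the sample size `n`, where `Q` is the law of
the directions `T` and `g_{ζ,T}` is the estimator built from the single sample `ζ`:
`E_T[E_ζ ‖g_{ζ,T}(x) - g_T(x)‖²] / n ≤ θ² E_T ‖g_T(x)‖²`. -/
def NormCondition {d N : ℕ} {Ξ : Type*} [MeasurableSpace Ξ] (P : Measure Ξ)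
    (f : Vec d → Ξ → ℝ) (γ ν θ : ℝ) (Q : Measure (Fin N → Vec d)) (n : ℕ) (x : Vec d) : Prop :=
  (∫ u, ∫ ζ, ‖centralFD γ ν (fun y => f y ζ) u x - gT P f γ ν n u x‖ ^ 2 ∂P ∂Q) / (n : ℝ)
    ≤ θ ^ 2 * ∫ u, ‖gT P f γ ν n u x‖ ^ 2 ∂Q

/-! ### The five gradient estimation methods -/

/-- Standard finite differences, Gaussian smoothing, sphere smoothing, randomized coordinates,
randomized subspaces. -/
inductive FDMethod : Type
  | cFD | cGS | cSS | cRC | cRS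

/-- The uniform distribution on the unit sphere of `ℝ^d`, as a measure on `ℝ^d`. -/
noncomputable def uniformSphere (d : ℕ) : Measure (Vec d) :=
  ((volume : Measure (Vec d)).toSphere Set.univ)⁻¹ •
    ((volume : Measure (Vec d)).toSphere).map Subtype.val

/-- The law of `N` indices drawn uniformly without replacement from `d` indices. -/
noncomputable def uniformIndices (d N : ℕ) : Measure (Fin N → Fin d) :=
  uniformOn {σ : Fin N → Fin d | Function.Injective σ}

/-- `Q` is an admissible law of the `N` directions `T = (u_1, …, u_N)` for the method.
cFD: the `d` canonical vectors. cGS: i.i.d. standard Gaussian vectors. cSS: i.i.d. uniform vectors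
on the unit sphere. cRC: `N` canonical vectors drawn uniformly without replacement. cRS: `N`
vectors drawn uniformly without replacement from a random orthonormal basis, which has an
arbitrary law `ρ` and is independent of the drawn indices. -/
def IsDirectionLaw {d N : ℕ} (Q : Measure (Fin N → Vec d)) : FDMethod → Prop
  | .cFD => ∃ h : N = d,
      Q = Measure.dirac fun j => EuclideanSpace.basisFun (Fin d) ℝ (Fin.cast h j)
  | .cGS => Q = Measure.pi fun _ => stdGaussian (Vec d)
  | .cSS => Q = Measure.pi fun _ => uniformSphere d
  | .cRC => N ≤ d ∧
      Q = (uniformIndices d N).map fun σ j => EuclideanSpace.basisFun (Fin d) ℝ (σ j)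
  | .cRS => N ≤ d ∧ ∃ ρ : Measure (Fin d → Vec d), IsProbabilityMeasure ρ ∧
      (∀ᵐ B ∂ρ, Orthonormal ℝ B) ∧
      Q = (ρ.prod (uniformIndices d N)).map fun q j => q.1 (q.2 j)

/-- The scaling coefficient `γ`. -/
noncomputable def scaling (d N : ℕ) : FDMethod → ℝ
  | .cFD => 1
  | .cGS => 1 / (N : ℝ)
  | .cSS => (d : ℝ) / N
  | .cRC => (d : ℝ) / N
  | .cRS => (d : ℝ) / N

/-- The quantity `Ω₁ = 1 / (4 (1 + θ²) L_F)`. -/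
noncomputable def Omega₁ (θ L : ℝ) : ℝ := 1 / (4 * (1 + θ ^ 2) * L)

/-- The quantity `Ω₂ = d M_F² ν⁴ / 48`. -/
noncomputable def Omega₂ (d : ℕ) (M ν : ℝ) : ℝ := (d : ℝ) * M ^ 2 * ν ^ 4 / 48

/-- The constant step size `ᾱ` of the method. -/
noncomputable def stepSize (d N : ℕ) (θ L : ℝ) : FDMethod → ℝ
  | .cFD => Omega₁ θ L
  | .cGS => (N : ℝ) / (N + 4.5 * d) * Omega₁ θ L
  | .cSS => (N : ℝ) / (N + 4.5 * d) * Omega₁ θ L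
  | .cRC => (N : ℝ) / d * Omega₁ θ L
  | .cRS => (N : ℝ) / d * Omega₁ θ L

/-- The neighborhood parameter `χ̄` of the method. -/
noncomputable def chiBar (d N : ℕ) (M ν : ℝ) : FDMethod → ℝ
  | .cFD => Omega₂ d M ν
  | .cGS => (72 * (N : ℝ) * d + 216 * (d : ℝ) ^ 2 + ((d : ℝ) + 2) * (d + 4) * (d + 6))
      / (2 * (N + 4.5 * d)) * Omega₂ d M ν
  | .cSS => (72 * (N : ℝ) + 216 * d + (d : ℝ) ^ 2)
      / (2 * d * (N + 4.5 * d)) * Omega₂ d M ν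
  | .cRC => Omega₂ d M ν
  | .cRS => Omega₂ d M ν

/-! ### The iteration -/

/-- A run of the iteration `x_{k+1} = x_k - α g_{S_k,T_k}(x_k)` with `N` directions per step.

`ℱ k` is the information available before step `k`. At step `k` the directions `T k` are drawn from
the law of the method and the samples `ζ k 0, ζ k 1, …` are drawn i.i.d. from `P`, independently of
each other and, jointly, of `ℱ k`. The sample set `S_k` consists of the first `size k` samples,
where `size k` is determined by `ℱ k` and satisfies the theoretical norm condition at `x_k`. -/
structure IsAdaptiveCFDRun {d N : ℕ} {Ξ Ω : Type*} [MeasurableSpace Ξ] [mΩ : MeasurableSpace Ω]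
    (P : Measure Ξ) (f : Vec d → Ξ → ℝ) (m : FDMethod) (ν θ α : ℝ) (x₀ : Vec d)
    (μ : Measure Ω) (ℱ : Filtration ℕ mΩ) (T : ℕ → Ω → Fin N → Vec d) (ζ : ℕ → ℕ → Ω → Ξ)
    (size : ℕ → Ω → ℕ) (x : ℕ → Ω → Vec d) : Prop where
  measurable_dir : ∀ k, Measurable[ℱ (k + 1)] (T k)
  measurable_sample : ∀ k i, Measurable[ℱ (k + 1)] (ζ k i)
  dir_law : ∀ k, IsDirectionLaw (μ.map (T k)) m
  sample_law : ∀ k i, μ.map (ζ k i) = P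
  sample_indep : ∀ k, iIndepFun (ζ k) μ
  dir_indep_sample : ∀ k, IndepFun (T k) (fun ω i => ζ k i ω) μ
  indep_past : ∀ k, Indep
    (MeasurableSpace.comap (fun ω => (T k ω, fun i => ζ k i ω)) inferInstance) (ℱ k) μ
  measurable_size : ∀ k, Measurable[ℱ k] (size k)
  size_pos : ∀ k ω, 0 < size k ω
  norm_condition : ∀ k, ∀ᵐ ω ∂μ,
    NormCondition P f (scaling d N m) ν θ (μ.map (T k)) (size k ω) (x k ω)
  init : ∀ ω, x 0 ω = x₀
  step : ∀ k ω, x (k + 1) ω = x k ω - α •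
    gST f (scaling d N m) ν (fun i : Fin (size k ω) => ζ k i ω) (T k ω) (x k ω)

/-! ### Smoothness of functions and of their expectations -/

/-! Write G = ∇F(x) and let g_T be the central difference estimator of F itself. The Lipschitz
gradient of F gives, for one step from x, F(x⁺) ≤ F(x) - α(⟨G, g_{S,T}⟩ - (Lα/2)‖g_{S,T}‖²).
Conditionally on the past, x and the sample size are frozen. Averaging over i.i.d. samples is
unbiased and divides the variance by |S|, so the norm condition yields E‖g_{S,T}‖² ≤ (1 + θ²)
E‖g_T‖² (`integral_norm_sq_gST_le`). Let κ be the ratio of the step size to Ω₁. Then (Lα/2)(1 + θ²)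
= κ/8, and the expected decrease (`expected_descent`) follows from an estimate about F and the
directions alone: ‖G‖²/4 - χ̄ ≤ E_T[⟨G, g_T⟩ - (κ/8)‖g_T‖²] (`IsDirectionLaw.descent_estimate`).
Telescoping, bounding a minimum by an average, and Markov's inequality finish the argument.

There are two ways to the direction estimate. Orthonormal directions (cFD, cRC, cRS) produce no
cross terms in ‖g_T‖², so the estimate is a scalar inequality for each direction, averaged by
Parseval's identity. For i.i.d. directions with an isometry invariant law (cGS, cSS), one bounds the
bias E g_T - G and the second moment. The bias along a unit vector v is found by pairing u with its
mirror image in the hyperplane orthogonal to v: the difference of the two quotients has error O(|⟨v,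
u⟩| ‖u‖²) rather than O(‖u‖³), and only moments of even order remain
(`IsometryInvariant.abs_integral_centralQuotient_mul_inner_sub_le`). The second moment needs E‖u‖⁴
and E‖u‖⁸.

Integrability travels along the iteration with F(x_k) alone, because ‖∇F‖² ≤ 2L(F - inf F). -/

lemma norm_gradient_sub_eq {d : ℕ} (φ : Vec d → ℝ) (x y : Vec d) :
    ‖gradient φ x - gradient φ y‖ = ‖fderiv ℝ φ x - fderiv ℝ φ y‖ := by
  rw [gradient, gradient, ← map_sub, LinearIsometryEquiv.norm_map]

lemma contDiff_gradient {d : ℕ} {φ : Vec d → ℝ} (h : ContDiff ℝ 2 φ) :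
    ContDiff ℝ 1 (gradient φ) := by
  have h1 : ContDiff ℝ 1 (fderiv ℝ φ) := h.fderiv_right (by norm_num)
  exact (InnerProductSpace.toDual ℝ (Vec d)).symm.contDiff.comp h1

lemma hasFDerivAt_shift_sub {d : ℕ} {G : Type*} [NormedAddCommGroup G] [NormedSpace ℝ G]
    {φ : Vec d → G} (h : Differentiable ℝ φ) (x y z : Vec d) :
    HasFDerivAt (fun z => φ (x + z) - φ (y + z)) (fderiv ℝ φ (x + z) - fderiv ℝ φ (y + z)) z := by
  have h1 (w : Vec d) : HasFDerivAt (fun z => φ (w + z)) (fderiv ℝ φ (w + z)) z := by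
    simpa using (hasFDerivAt_comp_add_left w).2 (h (w + z)).hasFDerivAt
  exact (h1 x).sub (h1 y)

/-- Mean value inequality for `z ↦ φ (x + z) - φ (y + z)`. Such mixed second differences are linear
in `φ`, so bounds on them pass to expectations. -/
lemma norm_shift_sub_le {d : ℕ} {G : Type*} [NormedAddCommGroup G] [NormedSpace ℝ G]
    {φ : Vec d → G} {C : ℝ} (h : Differentiable ℝ φ)
    (hC : ∀ x y, ‖fderiv ℝ φ x - fderiv ℝ φ y‖ ≤ C * ‖x - y‖) (x y z w : Vec d) :
    ‖(φ (x + z) - φ (y + z)) - (φ (x + w) - φ (y + w))‖ ≤ C * ‖x - y‖ * ‖z - w‖ := by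
  refine Convex.norm_image_sub_le_of_norm_hasFDerivWithin_le (s := Set.univ) (𝕜 := ℝ)
    (f := fun z => φ (x + z) - φ (y + z))
    (fun z _ => (hasFDerivAt_shift_sub h x y z).hasFDerivWithinAt) (fun z _ => ?_)
    convex_univ (Set.mem_univ _) (Set.mem_univ _)
  simpa using hC (x + z) (y + z)

/-- Converse of the preceding bound: the derivative at `z = 0` of `z ↦ φ (x + z) - φ (y + z)` is the
difference of the two derivatives. With it no differentiation under the integral sign is needed. -/
lemma norm_fderiv_sub_le_of_shift {d : ℕ} {G : Type*} [NormedAddCommGroup G] [NormedSpace ℝ G]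
    {φ : Vec d → G} (h : Differentiable ℝ φ) {x y : Vec d} {C : ℝ} (hC : 0 ≤ C)
    (hle : ∀ z, ‖(φ (x + z) - φ (y + z)) - (φ x - φ y)‖ ≤ C * ‖z‖) :
    ‖fderiv ℝ φ x - fderiv ℝ φ y‖ ≤ C := by
  have := hasFDerivAt_shift_sub h x y 0
  simp only [add_zero] at this
  refine this.le_of_lip' hC (Filter.Eventually.of_forall fun z => ?_)
  simpa using hle z

/-- An expectation of functions with `C`-Lipschitz gradients has a `C`-Lipschitz gradient. -/
lemma norm_gradient_objective_sub_le {d : ℕ} {Ξ : Type*} [MeasurableSpace Ξ] {P : Measure Ξ}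
    [IsProbabilityMeasure P] {φ : Vec d → Ξ → ℝ} {C : ℝ} (hint : ∀ x, Integrable (φ x) P)
    (hdiff : ∀ ζ, Differentiable ℝ fun x => φ x ζ)
    (hlip : ∀ ζ x y, ‖gradient (fun x => φ x ζ) x - gradient (fun x => φ x ζ) y‖ ≤ C * ‖x - y‖)
    (hF : Differentiable ℝ (objective P φ)) (x y : Vec d) :
    ‖gradient (objective P φ) x - gradient (objective P φ) y‖ ≤ C * ‖x - y‖ := by
  obtain ⟨ζ₀⟩ : Nonempty Ξ := nonempty_of_isProbabilityMeasure P
  rw [norm_gradient_sub_eq]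
  refine norm_fderiv_sub_le_of_shift hF ((norm_nonneg _).trans (hlip ζ₀ x y)) fun z => ?_
  have h1 : (objective P φ (x + z) - objective P φ (y + z)) - (objective P φ x - objective P φ y)
      = ∫ ζ, (φ (x + z) ζ - φ (y + z) ζ) - (φ x ζ - φ y ζ) ∂P := by
    have h2 (a b : Vec d) : Integrable (fun ζ => φ a ζ - φ b ζ) P := (hint a).sub (hint b)
    rw [integral_sub (h2 _ _) (h2 _ _), integral_sub (hint _) (hint _),
      integral_sub (hint _) (hint _)]
    rfl
  rw [h1]
  refine (norm_integral_le_of_norm_le_const (C := C * ‖x - y‖ * ‖z‖)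
    (Filter.Eventually.of_forall fun ζ => ?_)).trans (by simp)
  have := norm_shift_sub_le (hdiff ζ) (C := C)
    (fun a b => by rw [← norm_gradient_sub_eq]; exact hlip ζ a b) x y z 0
  simpa using this

/-- The Hessian bound is the gradient bound applied once more, to the integrand `z ↦ f (x + z) ζ - f
(y + z) ζ`. Its gradient is Lipschitz with constant `M * ‖x - y‖`, which is then inherited by `∇F(x
+ z) - ∇F(y + z)`. -/
theorem hasLipschitzGradHess_objective {d : ℕ} {Ξ : Type*} [MeasurableSpace Ξ] {P : Measure Ξ}
    [IsProbabilityMeasure P] {f : Vec d → Ξ → ℝ} {L M : ℝ} (h : SmoothAssumption P f L M) :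
    HasLipschitzGradHess (objective P f) L M := by
  have hF := h.contDiff_objective.differentiable (by norm_num)
  have hf (ζ : Ξ) := (h.contDiff ζ).differentiable (by norm_num)
  refine ⟨norm_gradient_objective_sub_le h.integrable hf (fun ζ => (h.lipschitz ζ).1) hF,
    fun x y => ?_⟩
  have hgF : Differentiable ℝ (gradient (objective P f)) :=
    (contDiff_gradient h.contDiff_objective).differentiable (by norm_num)
  have hgf (ζ : Ξ) : Differentiable ℝ (gradient fun x => f x ζ) :=
    (contDiff_gradient (h.contDiff ζ)).differentiable (by norm_num)
  have grad_shift {φ : Vec d → ℝ} (hφ : Differentiable ℝ φ) (z : Vec d) :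
      gradient (fun z => φ (x + z) - φ (y + z)) z = gradient φ (x + z) - gradient φ (y + z) := by
    rw [gradient, (hasFDerivAt_shift_sub hφ x y z).fderiv, map_sub]; rfl
  obtain ⟨ζ₀⟩ : Nonempty Ξ := nonempty_of_isProbabilityMeasure P
  refine norm_fderiv_sub_le_of_shift hgF ((norm_nonneg _).trans ((h.lipschitz ζ₀).2 x y))
    fun z => ?_
  have hobj : objective P (fun z ζ => f (x + z) ζ - f (y + z) ζ)
      = fun z => objective P f (x + z) - objective P f (y + z) := by
    ext z; exact integral_sub (h.integrable _) (h.integrable _)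
  have := norm_gradient_objective_sub_le (P := P) (φ := fun z ζ => f (x + z) ζ - f (y + z) ζ)
    (C := M * ‖x - y‖) (fun z => (h.integrable _).sub (h.integrable _))
    (fun ζ z => (hasFDerivAt_shift_sub (hf ζ) x y z).differentiableAt)
    (fun ζ a b => by
      rw [grad_shift (hf ζ), grad_shift (hf ζ)]
      exact norm_shift_sub_le (hgf ζ) (h.lipschitz ζ).2 x y a b)
    (by rw [hobj]; exact fun z => (hasFDerivAt_shift_sub hF x y z).differentiableAt) z 0
  rw [hobj, grad_shift hF, grad_shift hF] at this
  simpa using this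

/-! ### Taylor estimates along segments -/

lemma hasDerivAt_line {d : ℕ} {G : Type*} [NormedAddCommGroup G] [NormedSpace ℝ G]
    {φ : Vec d → G} (h : Differentiable ℝ φ) (x w : Vec d) (t : ℝ) :
    HasDerivAt (fun t : ℝ => φ (x + t • w)) (fderiv ℝ φ (x + t • w) w) t := by
  have h1 : HasDerivAt (fun t : ℝ => x + t • w) w t := by
    simpa using ((hasDerivAt_id t).smul_const w).const_add x
  exact (h (x + t • w)).hasFDerivAt.comp_hasDerivAt t h1

/-- A function on `[0, 1]` vanishing at `0` with `‖φ'(t)‖ ≤ (n + 1) c tⁿ` has `‖φ(1)‖ ≤ c`. -/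
lemma norm_le_of_norm_deriv_le_pow {G : Type*} [NormedAddCommGroup G] [NormedSpace ℝ G]
    {φ φ' : ℝ → G} (h : ∀ t, HasDerivAt φ (φ' t) t) (h0 : φ 0 = 0) {c : ℝ} (n : ℕ)
    (hle : ∀ t, 0 ≤ t → ‖φ' t‖ ≤ (n + 1) * c * t ^ n) : ‖φ 1‖ ≤ c := by
  have hB (t : ℝ) : HasDerivAt (fun t : ℝ => c * t ^ (n + 1)) ((n + 1) * c * t ^ n) t := by
    have := (hasDerivAt_pow (n + 1) t).const_mul c
    exact this.congr_deriv (by rw [Nat.add_sub_cancel]; push_cast; ring)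
  have := image_norm_le_of_norm_deriv_right_le_deriv_boundary (a := 0) (b := 1)
    (fun t _ => (h t).continuousAt.continuousWithinAt) (fun t _ => (h t).hasDerivWithinAt)
    (by simp [h0]) hB (fun t ht => hle t ht.1) (Set.right_mem_Icc.2 zero_le_one)
  simpa using this

section Taylor

variable {d : ℕ} {φ : Vec d → ℝ}

lemma abs_sub_sub_inner_gradient_le {L : ℝ} (h : Differentiable ℝ φ)
    (hL : ∀ x y, ‖gradient φ x - gradient φ y‖ ≤ L * ‖x - y‖) (x w : Vec d) :
    |φ (x + w) - φ x - inner ℝ (gradient φ x) w| ≤ L / 2 * ‖w‖ ^ 2 := by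
  have := norm_le_of_norm_deriv_le_pow (c := L / 2 * ‖w‖ ^ 2)
    (φ := fun t : ℝ => φ (x + t • w) - φ x - t * inner ℝ (gradient φ x) w)
    (fun t => ((hasDerivAt_line h x w t).sub_const (φ x)).sub
      (hasDerivAt_mul_const (inner ℝ (gradient φ x) w))) (by simp) 1 (fun t ht => by
      rw [← inner_gradient_left, ← inner_sub_left, Real.norm_eq_abs]
      refine (abs_real_inner_le_norm _ _).trans ?_
      have h1 := hL (x + t • w) x
      rw [add_sub_cancel_left, norm_smul, Real.norm_eq_abs, abs_of_nonneg ht] at h1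
      refine (mul_le_mul_of_nonneg_right h1 (norm_nonneg w)).trans (le_of_eq ?_)
      push_cast; ring)
  simpa using this

/-- Along `t * w` the derivative is the difference of the Hessians at two points at distance
`2t‖w‖`, applied to `w`. It is at most `2Mt‖w‖²`, which integrates to `M‖w‖²`. -/
lemma norm_gradient_symm_sub_le {M : ℝ} (h : Differentiable ℝ (gradient φ))
    (hM : ∀ x y, ‖fderiv ℝ (gradient φ) x - fderiv ℝ (gradient φ) y‖ ≤ M * ‖x - y‖)
    (x w : Vec d) :
    ‖gradient φ (x + w) + gradient φ (x - w) - (2 : ℝ) • gradient φ x‖ ≤ M * ‖w‖ ^ 2 := by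
  have := norm_le_of_norm_deriv_le_pow (c := M * ‖w‖ ^ 2)
    (φ := fun t : ℝ => gradient φ (x + t • w) + gradient φ (x + t • -w) - (2 : ℝ) • gradient φ x)
    (fun t => ((hasDerivAt_line h x w t).add (hasDerivAt_line h x (-w) t)).sub_const _)
    (by simp [two_smul]) 1 (fun t ht => by
      rw [map_neg, ← sub_eq_add_neg, ← sub_apply]
      refine (ContinuousLinearMap.le_opNorm _ _).trans ?_
      have h1 := hM (x + t • w) (x + t • -w)
      have h2 : x + t • w - (x + t • -w) = (2 * t) • w := by module
      rw [h2, norm_smul, Real.norm_eq_abs, abs_of_nonneg (by positivity)] at h1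
      refine (mul_le_mul_of_nonneg_right h1 (norm_nonneg w)).trans (le_of_eq ?_)
      push_cast; ring)
  simpa [sub_eq_add_neg] using this

/-- The derivative along `t * w` is the inner product of `w` with the symmetric second difference of
the gradient, at most `M t² ‖w‖³`. Integrating gives the factor 1/3; the symmetry is what makes the
error cubic. -/
lemma abs_central_sub_inner_gradient_le {M : ℝ} (hφ : Differentiable ℝ φ)
    (h : Differentiable ℝ (gradient φ))
    (hM : ∀ x y, ‖fderiv ℝ (gradient φ) x - fderiv ℝ (gradient φ) y‖ ≤ M * ‖x - y‖)
    (x w : Vec d) :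
    |φ (x + w) - φ (x - w) - 2 * inner ℝ (gradient φ x) w| ≤ M / 3 * ‖w‖ ^ 3 := by
  have := norm_le_of_norm_deriv_le_pow (c := M / 3 * ‖w‖ ^ 3)
    (φ := fun t : ℝ => φ (x + t • w) - φ (x + t • -w) - t * (2 * inner ℝ (gradient φ x) w))
    (fun t => ((hasDerivAt_line hφ x w t).sub (hasDerivAt_line hφ x (-w) t)).sub
      (hasDerivAt_mul_const (2 * inner ℝ (gradient φ x) w))) (by simp) 2 (fun t ht => by
      have e : fderiv ℝ φ (x + t • w) w - fderiv ℝ φ (x + t • -w) (-w)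
          - 2 * inner ℝ (gradient φ x) w = inner ℝ
            (gradient φ (x + t • w) + gradient φ (x - t • w) - (2 : ℝ) • gradient φ x) w := by
        rw [inner_sub_left, inner_add_left, inner_smul_left, inner_gradient_left,
          inner_gradient_left, map_neg, smul_neg, ← sub_eq_add_neg]
        simp
      rw [e, Real.norm_eq_abs]
      refine (abs_real_inner_le_norm _ _).trans ?_
      have h1 := norm_gradient_symm_sub_le h hM x (t • w)
      rw [norm_smul, Real.norm_eq_abs, abs_of_nonneg ht] at h1
      refine (mul_le_mul_of_nonneg_right h1 (norm_nonneg w)).trans (le_of_eq ?_)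
      push_cast; ring)
  simpa [sub_eq_add_neg] using this

end Taylor

/-! ### Central difference quotients -/

/-- The central difference quotient of `φ` at `x` along `u`. -/
noncomputable def centralQuotient {d : ℕ} (ν : ℝ) (φ : Vec d → ℝ) (x u : Vec d) : ℝ :=
  (φ (x + ν • u) - φ (x - ν • u)) / (2 * ν)

lemma centralFD_eq {d N : ℕ} (γ ν : ℝ) (φ : Vec d → ℝ) (u : Fin N → Vec d) (x : Vec d) :
    centralFD γ ν φ u x = γ • ∑ j, centralQuotient ν φ x (u j) • u j := rfl

lemma continuous_centralQuotient {d : ℕ} {ν : ℝ} {φ : Vec d → ℝ} (h : Continuous φ) (x : Vec d) :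
    Continuous (centralQuotient ν φ x) := by
  unfold centralQuotient; fun_prop

section Quotient

variable {d : ℕ} {φ : Vec d → ℝ} {M ν : ℝ}

lemma abs_centralQuotient_sub_le (hφ : ContDiff ℝ 2 φ)
    (hM : ∀ x y, ‖fderiv ℝ (gradient φ) x - fderiv ℝ (gradient φ) y‖ ≤ M * ‖x - y‖)
    (hν : 0 < ν) (x u : Vec d) :
    |centralQuotient ν φ x u - inner ℝ (gradient φ x) u| ≤ M * ν ^ 2 / 6 * ‖u‖ ^ 3 := by
  have h := abs_central_sub_inner_gradient_le (hφ.differentiable (by norm_num))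
    ((contDiff_gradient hφ).differentiable (by norm_num)) hM x (ν • u)
  rw [norm_smul, Real.norm_eq_abs, abs_of_pos hν, real_inner_smul_right] at h
  have e : centralQuotient ν φ x u - inner ℝ (gradient φ x) u =
      (φ (x + ν • u) - φ (x - ν • u) - 2 * (ν * inner ℝ (gradient φ x) u)) / (2 * ν) := by
    unfold centralQuotient; field_simp
  rw [e, abs_div, abs_of_pos (by positivity : 0 < 2 * ν), div_le_iff₀ (by positivity)]
  exact h.trans (le_of_eq (by ring))

/-- Comparison of the quotients along `u` and along its reflection `u - 2⟪v, u⟫v`. -/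
lemma abs_centralQuotient_sub_reflection_le (hφ : ContDiff ℝ 2 φ)
    (hM : ∀ x y, ‖fderiv ℝ (gradient φ) x - fderiv ℝ (gradient φ) y‖ ≤ M * ‖x - y‖)
    (hν : 0 < ν) (x u : Vec d) {v : Vec d} (hv : ‖v‖ = 1) :
    |centralQuotient ν φ x u - centralQuotient ν φ x (u - (2 * inner ℝ v u) • v)
      - 2 * inner ℝ v u * inner ℝ (gradient φ x) v|
      ≤ M * ν ^ 2 * (|inner ℝ v u| * (‖u‖ ^ 2 - 2 / 3 * inner ℝ v u ^ 2)) := by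
  set s : ℝ := inner ℝ v u with hs
  set p : Vec d := u - s • v with hp
  have hpn : ‖p‖ ^ 2 = ‖u‖ ^ 2 - s ^ 2 := by
    rw [hp, norm_sub_sq_real, inner_smul_right, real_inner_comm, ← hs, norm_smul, hv,
      Real.norm_eq_abs, mul_one, sq_abs]
    ring
  have hd := hφ.differentiable (by norm_num)
  have hg := (contDiff_gradient hφ).differentiable (by norm_num)
  -- The four evaluation points are `x ± νp ± h`: `u` and its reflection have the common part `p`
  -- orthogonal to `v`. The two chords parallel to `v`, centred at `x + νp` and `x - νp`, are
  -- compared with the gradients at their centres.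
  set h : Vec d := (ν * s) • v with hh
  have hn : ‖h‖ = ν * |s| := by
    rw [hh, norm_smul, hv, Real.norm_eq_abs, abs_mul, abs_of_pos hν, mul_one]
  have h1 := abs_central_sub_inner_gradient_le hd hg hM (x + ν • p) h
  have h2 := abs_central_sub_inner_gradient_le hd hg hM (x - ν • p) h
  have h3 := norm_gradient_symm_sub_le hg hM x (ν • p)
  have h4 : |inner ℝ (gradient φ (x + ν • p) + gradient φ (x - ν • p)
      - (2 : ℝ) • gradient φ x) h| ≤ M * ‖ν • p‖ ^ 2 * ‖h‖ :=
    (abs_real_inner_le_norm _ _).trans (mul_le_mul_of_nonneg_right h3 (norm_nonneg _))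
  rw [norm_smul, Real.norm_eq_abs, abs_of_pos hν, mul_pow, hpn, hn] at h4
  rw [hn] at h1 h2
  rw [inner_sub_left, inner_add_left, real_inner_smul_left] at h4
  have e1 : x + ν • p + h = x + ν • u := by rw [hp, hh]; module
  have e2 : x + ν • p - h = x + ν • (u - (2 * s) • v) := by rw [hp, hh]; module
  have e3 : x - ν • p + h = x - ν • (u - (2 * s) • v) := by rw [hp, hh]; module
  have e4 : x - ν • p - h = x - ν • u := by rw [hp, hh]; module
  rw [e1, e2] at h1
  rw [e3, e4] at h2
  have e5 : inner ℝ (gradient φ x) h = ν * s * inner ℝ (gradient φ x) v := by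
    rw [hh, real_inner_smul_right]
  rw [e5] at h4
  unfold centralQuotient
  rw [← sub_div]
  have e6 (a b : ℝ) : a / (2 * ν) - b = (a - b * (2 * ν)) / (2 * ν) := by field_simp
  rw [e6, abs_div, abs_of_pos (by positivity : 0 < 2 * ν), div_le_iff₀ (by positivity)]
  have e7 : |s| ^ 3 = |s| * s ^ 2 := by rw [pow_succ', sq_abs]
  have e8 : M / 3 * (ν * |s|) ^ 3 = M / 3 * ν ^ 3 * (|s| * s ^ 2) := by rw [mul_pow, e7]; ring
  rw [e8] at h1 h2
  rw [abs_le] at *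
  -- The chords contribute `2 * M/3 * ν³|s|³` and the symmetric gradient difference `2Mν³|s|(‖u‖² -
  -- s²)`. Division by `2ν` leaves `Mν²|s|(‖u‖² - 2/3 s²)`.
  constructor <;> linarith [h1.1, h1.2, h2.1, h2.2, h4.1, h4.2]

end Quotient

/-! ### Moments -/

lemma pow_le_one_add_pow_eight {t : ℝ} (ht : 0 ≤ t) {k : ℕ} (hk : k ≤ 8) : t ^ k ≤ 1 + t ^ 8 := by
  rcases le_total t 1 with h | h
  · linarith [pow_le_one₀ (n := k) ht h, pow_nonneg ht 8]
  · linarith [pow_le_pow_right₀ h hk]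

/-- The eighth moment governs all integrability below: the Taylor error of a quotient is of order
‖u‖³, it multiplies `u`, and the product is squared. -/
lemma Integrable.of_abs_le_norm_pow_eight {Ω : Type*} [MeasurableSpace Ω] {d : ℕ}
    {q : Measure Ω} [IsFiniteMeasure q] {U : Ω → Vec d} (h8 : Integrable (fun ω => ‖U ω‖ ^ 8) q)
    {h : Ω → ℝ} (hm : AEStronglyMeasurable h q) {C : ℝ}
    (hle : ∀ ω, |h ω| ≤ C * (1 + ‖U ω‖ ^ 8)) : Integrable h q :=
  (((integrable_const 1).add h8).const_mul C).mono' hm (Filter.Eventually.of_forall hle)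

/-- The second moment of a sum of i.i.d. random vectors. -/
lemma integral_norm_sum_sq_pi {E : Type*} [MeasurableSpace E] (q : Measure E)
    [IsProbabilityMeasure q] {d : ℕ} {Y : E → Vec d} (hm : Measurable Y) (hY : MemLp Y 2 q)
    (n : ℕ) :
    ∫ s : Fin n → E, ‖∑ i, Y (s i)‖ ^ 2 ∂(Measure.pi fun _ => q)
      = n * ∫ z, ‖Y z‖ ^ 2 ∂q + n * (n - 1) * ‖∫ z, Y z ∂q‖ ^ 2 := by
  set π : Measure (Fin n → E) := Measure.pi fun _ => q
  have hYi (i : Fin n) : MemLp (fun s : Fin n → E => Y (s i)) 2 π :=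
    hY.comp_measurePreserving (measurePreserving_eval _ i)
  have hint (i j : Fin n) : Integrable (fun s : Fin n → E => inner ℝ (Y (s i)) (Y (s j))) π := by
    refine (((hYi i).integrable_norm_pow two_ne_zero).add
      ((hYi j).integrable_norm_pow two_ne_zero)).mono'
      ((hYi i).aestronglyMeasurable.inner (hYi j).aestronglyMeasurable)
      (Filter.Eventually.of_forall fun s => ?_)
    refine (norm_inner_le_norm _ _).trans ?_
    simp only [Pi.add_apply]
    nlinarith [sq_nonneg (‖Y (s i)‖ - ‖Y (s j)‖), sq_nonneg (‖Y (s i)‖ + ‖Y (s j)‖)]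
  have hval (i j : Fin n) : ∫ s : Fin n → E, inner ℝ (Y (s i)) (Y (s j)) ∂π
      = if i = j then ∫ z, ‖Y z‖ ^ 2 ∂q else ‖∫ z, Y z ∂q‖ ^ 2 := by
    split_ifs with hij
    · subst hij
      simp_rw [real_inner_self_eq_norm_sq]
      exact integral_comp_eval (μ := fun _ : Fin n => q) (f := fun z => ‖Y z‖ ^ 2)
        (by fun_prop)
    · have hind : IndepFun (fun s : Fin n → E => Y (s i)) (fun s => Y (s j)) π :=
        (iIndepFun_pi (μ := fun _ : Fin n => q) (X := fun _ => Y)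
          fun _ => hm.aemeasurable).indepFun hij
      have h1 : ∫ s : Fin n → E, inner ℝ (Y (s i)) (Y (s j)) ∂π
          = inner ℝ (∫ s : Fin n → E, Y (s i) ∂π) (∫ s : Fin n → E, Y (s j) ∂π) :=
        hind.integral_bilin ((hYi i).integrable one_le_two) ((hYi j).integrable one_le_two)
          (innerSL ℝ)
      have h2 (k : Fin n) : ∫ s : Fin n → E, Y (s k) ∂π = ∫ z, Y z ∂q :=
        integral_comp_eval (μ := fun _ : Fin n => q) hm.aestronglyMeasurable
      rw [h1, h2, h2, real_inner_self_eq_norm_sq]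
  have hexp (s : Fin n → E) : ‖∑ i, Y (s i)‖ ^ 2 = ∑ i, ∑ j, inner ℝ (Y (s i)) (Y (s j)) := by
    rw [← real_inner_self_eq_norm_sq, sum_inner]
    simp_rw [inner_sum]
  simp_rw [hexp]
  rw [integral_finsetSum _ fun i _ => integrable_finsetSum _ fun j _ => hint i j]
  simp_rw [integral_finsetSum _ fun j _ => hint _ j, hval]
  have hsum (i : Fin n) : ∑ j, (if i = j then ∫ z, ‖Y z‖ ^ 2 ∂q else ‖∫ z, Y z ∂q‖ ^ 2)
      = ∫ z, ‖Y z‖ ^ 2 ∂q + (n - 1) * ‖∫ z, Y z ∂q‖ ^ 2 := by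
    have h1 (j : Fin n) : (if i = j then ∫ z, ‖Y z‖ ^ 2 ∂q else ‖∫ z, Y z ∂q‖ ^ 2)
        = (if i = j then ∫ z, ‖Y z‖ ^ 2 ∂q - ‖∫ z, Y z ∂q‖ ^ 2 else 0)
          + ‖∫ z, Y z ∂q‖ ^ 2 := by split_ifs <;> ring
    simp_rw [h1, Finset.sum_add_distrib, Finset.sum_ite_eq]
    simp
    ring
  simp_rw [hsum]
  simp
  ring

/-! ### Isotropic distributions -/

/-- Invariance of a measure under all linear isometries. -/
def IsometryInvariant {d : ℕ} (q : Measure (Vec d)) : Prop :=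
  ∀ e : Vec d ≃ₗᵢ[ℝ] Vec d, q.map e = q

namespace IsometryInvariant

variable {d : ℕ} {q : Measure (Vec d)}

lemma integral_comp (hq : IsometryInvariant q) (e : Vec d ≃ₗᵢ[ℝ] Vec d) (h : Vec d → ℝ) :
    ∫ u, h (e u) ∂q = ∫ u, h u ∂q := by
  conv_rhs => rw [← hq e]
  exact (e.toHomeomorph.measurableEmbedding.integral_map h).symm

/-- Reflection in the hyperplane orthogonal to `v - w` exchanges `v` and `w` and preserves the law.
-/
lemma integral_inner_pow_mul_norm_pow_congr (hq : IsometryInvariant q) {v w : Vec d}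
    (h : ‖v‖ = ‖w‖) (k l : ℕ) :
    ∫ u, inner ℝ v u ^ k * ‖u‖ ^ l ∂q = ∫ u, inner ℝ w u ^ k * ‖u‖ ^ l ∂q := by
  have e := hq.integral_comp (ℝ ∙ (v - w))ᗮ.reflection fun u => inner ℝ w u ^ k * ‖u‖ ^ l
  rw [← e]
  refine integral_congr_ae (Filter.Eventually.of_forall fun u => ?_)
  have : inner ℝ w ((ℝ ∙ (v - w))ᗮ.reflection u) = inner ℝ v u := by
    have h1 := Submodule.reflection_sub h
    rw [← LinearIsometryEquiv.inner_map_map (ℝ ∙ (v - w))ᗮ.reflection v u, h1]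
  simp [this]

/-- All directions have the same moment, so it equals the average over an orthonormal basis, where
the squared coordinates add up to ‖u‖². -/
lemma integral_inner_sq_mul_norm_pow (hq : IsometryInvariant q) [IsProbabilityMeasure q]
    (h8 : Integrable (fun u => ‖u‖ ^ 8) q) (v : Vec d) {l : ℕ} (hl : l ≤ 6) :
    d * ∫ u, inner ℝ v u ^ 2 * ‖u‖ ^ l ∂q = ‖v‖ ^ 2 * ∫ u, ‖u‖ ^ (l + 2) ∂q := by
  let b := EuclideanSpace.basisFun (Fin d) ℝ
  have hint (w : Vec d) : Integrable (fun u => inner ℝ w u ^ 2 * ‖u‖ ^ l) q := by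
    refine Integrable.of_abs_le_norm_pow_eight (U := id) (C := ‖w‖ ^ 2) h8
      (Continuous.aestronglyMeasurable (by fun_prop)) fun u => ?_
    rw [abs_mul, abs_pow, abs_pow, abs_norm]
    calc |inner ℝ w u| ^ 2 * ‖u‖ ^ l ≤ (‖w‖ * ‖u‖) ^ 2 * ‖u‖ ^ l := by
          gcongr; exact abs_real_inner_le_norm _ _
      _ = ‖w‖ ^ 2 * ‖u‖ ^ (l + 2) := by ring
      _ ≤ _ := by gcongr; exact pow_le_one_add_pow_eight (norm_nonneg _) (by omega)
  have h1 (i : Fin d) : ∫ u, inner ℝ v u ^ 2 * ‖u‖ ^ l ∂q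
      = ‖v‖ ^ 2 * ∫ u, inner ℝ (b i) u ^ 2 * ‖u‖ ^ l ∂q := by
    rw [hq.integral_inner_pow_mul_norm_pow_congr (w := ‖v‖ • b i) (by simp [norm_smul]) 2 l,
      ← integral_const_mul]
    congr with u
    rw [real_inner_smul_left]; ring
  have h2 : ∑ i : Fin d, ∫ u, inner ℝ v u ^ 2 * ‖u‖ ^ l ∂q
      = ∑ i : Fin d, ‖v‖ ^ 2 * ∫ u, inner ℝ (b i) u ^ 2 * ‖u‖ ^ l ∂q :=
    Finset.sum_congr rfl fun i _ => h1 i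
  rw [← Finset.mul_sum, ← integral_finsetSum _ fun i _ => hint (b i)] at h2
  simp only [Finset.sum_const, Finset.card_univ, Fintype.card_fin, nsmul_eq_mul] at h2
  rw [h2]
  congr 2 with u
  rw [← Finset.sum_mul, b.sum_sq_inner_right, ← pow_add, add_comm]

end IsometryInvariant

/-! ### Second moment bounds for central differences along random directions -/

section CentralMoments

variable {d : ℕ} {φ : Vec d → ℝ} {M ν : ℝ}

lemma sq_centralQuotient_mul_norm_le (hφ : ContDiff ℝ 2 φ)
    (hM : ∀ x y, ‖fderiv ℝ (gradient φ) x - fderiv ℝ (gradient φ) y‖ ≤ M * ‖x - y‖)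
    (hν : 0 < ν) (x u : Vec d) :
    (centralQuotient ν φ x u * ‖u‖) ^ 2 ≤
      2 * (inner ℝ (gradient φ x) u ^ 2 * ‖u‖ ^ 2) + 2 * (M * ν ^ 2 / 6) ^ 2 * ‖u‖ ^ 8 := by
  have h1 := abs_centralQuotient_sub_le hφ hM hν x u
  set c := centralQuotient ν φ x u
  set a := inner ℝ (gradient φ x) u
  have h2 : (c - a) ^ 2 ≤ (M * ν ^ 2 / 6 * ‖u‖ ^ 3) ^ 2 := sq_le_sq' (by
    linarith [(abs_le.1 h1).1]) (abs_le.1 h1).2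
  have h3 : c ^ 2 ≤ 2 * a ^ 2 + 2 * (M * ν ^ 2 / 6 * ‖u‖ ^ 3) ^ 2 := by
    -- `(c - 2a)² ≥ 0` rearranges to `c² ≤ 2a² + 2(c - a)²`.
    nlinarith [sq_nonneg (c - 2 * a)]
  calc (c * ‖u‖) ^ 2 = c ^ 2 * ‖u‖ ^ 2 := by ring
    _ ≤ (2 * a ^ 2 + 2 * (M * ν ^ 2 / 6 * ‖u‖ ^ 3) ^ 2) * ‖u‖ ^ 2 := by gcongr
    _ = _ := by ring

variable {Ω : Type*} [MeasurableSpace Ω] {q : Measure Ω} [IsFiniteMeasure q] {U : Ω → Vec d}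

lemma integrable_inner_sq_mul_norm_sq (h8 : Integrable (fun ω => ‖U ω‖ ^ 8) q)
    (hU : Measurable U) (v : Vec d) :
    Integrable (fun ω => inner ℝ v (U ω) ^ 2 * ‖U ω‖ ^ 2) q := by
  refine Integrable.of_abs_le_norm_pow_eight (C := ‖v‖ ^ 2) h8
    (Measurable.aestronglyMeasurable (by fun_prop)) fun ω => ?_
  rw [abs_mul, abs_pow, abs_pow, abs_norm]
  calc |inner ℝ v (U ω)| ^ 2 * ‖U ω‖ ^ 2 ≤ (‖v‖ * ‖U ω‖) ^ 2 * ‖U ω‖ ^ 2 := by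
        gcongr; exact abs_real_inner_le_norm _ _
    _ = ‖v‖ ^ 2 * ‖U ω‖ ^ 4 := by ring
    _ ≤ _ := by gcongr; exact pow_le_one_add_pow_eight (norm_nonneg _) (by omega)

lemma memLp_centralQuotient_smul (hφ : ContDiff ℝ 2 φ)
    (hM : ∀ x y, ‖fderiv ℝ (gradient φ) x - fderiv ℝ (gradient φ) y‖ ≤ M * ‖x - y‖)
    (hν : 0 < ν) (h8 : Integrable (fun ω => ‖U ω‖ ^ 8) q) (hU : Measurable U) (x : Vec d) :
    MemLp (fun ω => centralQuotient ν φ x (U ω) • U ω) 2 q := by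
  have hc : Measurable fun ω => centralQuotient ν φ x (U ω) :=
    (continuous_centralQuotient hφ.continuous x).measurable.comp hU
  have hm : Measurable fun ω => centralQuotient ν φ x (U ω) • U ω := hc.smul hU
  rw [memLp_two_iff_integrable_sq_norm hm.aestronglyMeasurable]
  refine (((integrable_inner_sq_mul_norm_sq h8 hU (gradient φ x)).const_mul 2).add
    (h8.const_mul (2 * (M * ν ^ 2 / 6) ^ 2))).mono' (by fun_prop)
    (Filter.Eventually.of_forall fun ω => ?_)
  rw [norm_smul, Real.norm_eq_abs, Real.norm_eq_abs, abs_of_nonneg (sq_nonneg _), mul_pow, sq_abs,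
    ← mul_pow]
  exact sq_centralQuotient_mul_norm_le hφ hM hν x (U ω)

lemma memLp_centralFD (hφ : ContDiff ℝ 2 φ)
    (hM : ∀ x y, ‖fderiv ℝ (gradient φ) x - fderiv ℝ (gradient φ) y‖ ≤ M * ‖x - y‖)
    (hν : 0 < ν) {N : ℕ} {Q : Measure (Fin N → Vec d)} [IsFiniteMeasure Q]
    (h8 : ∀ j, Integrable (fun u => ‖u j‖ ^ 8) Q) (γ : ℝ) (x : Vec d) :
    MemLp (fun u => centralFD γ ν φ u x) 2 Q := by
  simp_rw [centralFD_eq]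
  exact (memLp_finsetSum _ fun j _ =>
    memLp_centralQuotient_smul hφ hM hν (h8 j) (measurable_pi_apply j) x).const_smul γ

end CentralMoments

/-! ### Estimates for independent isotropic directions -/

namespace IsometryInvariant

variable {d : ℕ} {q : Measure (Vec d)} {φ : Vec d → ℝ} {M ν : ℝ}

/-- The reflection `e` in the hyperplane orthogonal to `v` preserves `q` and changes the sign of
`⟨v, u⟩`. Hence twice the mean of `c(u)⟨v, u⟩` is the mean of `(c(u) - c(e u))⟨v, u⟩`, and the
pointwise comparison with the reflected quotient, multiplied by `|⟨v, u⟩|`, leaves only even powers.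
The direct Taylor bound would leave `|⟨v, u⟩| ‖u‖³`, which costs an extra factor of order `√d`. -/
lemma abs_integral_centralQuotient_mul_inner_sub_le (hq : IsometryInvariant q)
    [IsProbabilityMeasure q] (h8 : Integrable (fun u => ‖u‖ ^ 8) q) (hφ : ContDiff ℝ 2 φ)
    (hM : ∀ x y, ‖fderiv ℝ (gradient φ) x - fderiv ℝ (gradient φ) y‖ ≤ M * ‖x - y‖)
    (hν : 0 < ν) (x : Vec d) {v : Vec d} (hv : ‖v‖ = 1) :
    |∫ u, centralQuotient ν φ x u * inner ℝ v u ∂q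
        - inner ℝ (gradient φ x) v * ∫ u, inner ℝ v u ^ 2 ∂q|
      ≤ M * ν ^ 2 / 2 *
        (∫ u, inner ℝ v u ^ 2 * ‖u‖ ^ 2 ∂q - 2 / 3 * ∫ u, inner ℝ v u ^ 4 ∂q) := by
  let e : Vec d ≃ₗᵢ[ℝ] Vec d := (ℝ ∙ v)ᗮ.reflection
  have he (u : Vec d) : e u = u - (2 * inner ℝ v u) • v := by
    have h1 : e u = -(ℝ ∙ v).reflection u := Submodule.reflection_orthogonal_apply _ u
    rw [h1, Submodule.reflection_singleton_apply, hv]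
    simp only [RCLike.ofReal_one, one_pow, div_one]
    module
  have hie (u : Vec d) : inner ℝ v (e u) = -inner ℝ v u := by
    rw [he, inner_sub_right, inner_smul_right, real_inner_self_eq_norm_sq, hv]; ring
  have hI (w : Vec d) (hw : ‖w‖ = 1) (k : ℕ) (hk : k ≤ 8) :
      Integrable (fun u => inner ℝ w u ^ k) q := by
    refine Integrable.of_abs_le_norm_pow_eight (U := id) (C := 1) h8
      (Continuous.aestronglyMeasurable (by fun_prop)) fun u => ?_
    rw [abs_pow, one_mul]
    refine le_trans (pow_le_pow_left₀ (abs_nonneg _) ?_ k)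
      (pow_le_one_add_pow_eight (norm_nonneg _) hk)
    simpa [hw] using abs_real_inner_le_norm w u
  have hI2 : Integrable (fun u => inner ℝ v u ^ 2 * ‖u‖ ^ 2) q :=
    integrable_inner_sq_mul_norm_sq (U := id) h8 measurable_id v
  have hIc : Integrable (fun u => centralQuotient ν φ x u * inner ℝ v u) q := by
    have h1 := (memLp_centralQuotient_smul (U := id) hφ hM hν h8 measurable_id x).integrable
      one_le_two
    have h2 := h1.const_inner (𝕜 := ℝ) v
    simpa only [id, real_inner_smul_right] using h2
  have hIe : Integrable (fun u => centralQuotient ν φ x (e u) * inner ℝ v u) q := by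
    have h1 : Integrable (fun u => centralQuotient ν φ x (e u) * inner ℝ v (e u)) q := by
      have : Integrable (fun u => centralQuotient ν φ x u * inner ℝ v u) (q.map e) := by
        rwa [hq e]
      exact (e.toHomeomorph.measurableEmbedding.integrable_map_iff).1 this
    refine h1.neg.congr (Filter.Eventually.of_forall fun u => ?_)
    simp [hie]
  have hsymm : ∫ u, centralQuotient ν φ x (e u) * inner ℝ v u ∂q
      = -∫ u, centralQuotient ν φ x u * inner ℝ v u ∂q := by
    have hee (u : Vec d) : e (e u) = u := Submodule.reflection_reflection _ u
    rw [← hq.integral_comp e, ← integral_neg]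
    simp [hie, hee]
  have hid : 2 * (∫ u, centralQuotient ν φ x u * inner ℝ v u ∂q
      - inner ℝ (gradient φ x) v * ∫ u, inner ℝ v u ^ 2 ∂q)
      = ∫ u, ((centralQuotient ν φ x u * inner ℝ v u - centralQuotient ν φ x (e u) * inner ℝ v u)
        - (2 * inner ℝ (gradient φ x) v) * inner ℝ v u ^ 2) ∂q := by
    have h1 : Integrable (fun u => centralQuotient ν φ x u * inner ℝ v u
      - centralQuotient ν φ x (e u) * inner ℝ v u) q := hIc.sub hIe
    rw [integral_sub h1 ((hI v hv 2 (by norm_num)).const_mul _),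
      integral_sub hIc hIe, hsymm, integral_const_mul]
    ring
  have hbd : |∫ u, ((centralQuotient ν φ x u * inner ℝ v u
        - centralQuotient ν φ x (e u) * inner ℝ v u)
        - (2 * inner ℝ (gradient φ x) v) * inner ℝ v u ^ 2) ∂q|
      ≤ ∫ u, M * ν ^ 2 * (inner ℝ v u ^ 2 * ‖u‖ ^ 2 - 2 / 3 * inner ℝ v u ^ 4) ∂q := by
    have h1 : Integrable (fun u => inner ℝ v u ^ 2 * ‖u‖ ^ 2 - 2 / 3 * inner ℝ v u ^ 4) q :=
      hI2.sub ((hI v hv 4 (by norm_num)).const_mul _)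
    rw [← Real.norm_eq_abs]
    refine norm_integral_le_of_norm_le (h1.const_mul _)
      (Filter.Eventually.of_forall fun u => ?_)
    have h2 := abs_centralQuotient_sub_reflection_le hφ hM hν x u hv
    rw [← he] at h2
    have h3 : (centralQuotient ν φ x u * inner ℝ v u - centralQuotient ν φ x (e u) * inner ℝ v u)
        - (2 * inner ℝ (gradient φ x) v) * inner ℝ v u ^ 2
        = (centralQuotient ν φ x u - centralQuotient ν φ x (e u)
          - 2 * inner ℝ v u * inner ℝ (gradient φ x) v) * inner ℝ v u := by ring
    rw [h3, Real.norm_eq_abs, abs_mul]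
    refine (mul_le_mul_of_nonneg_right h2 (abs_nonneg _)).trans (le_of_eq ?_)
    have h4 : |inner ℝ v u| * |inner ℝ v u| = inner ℝ v u ^ 2 := by rw [abs_mul_abs_self, sq]
    linear_combination (M * ν ^ 2 * (‖u‖ ^ 2 - 2 / 3 * inner ℝ v u ^ 2)) * h4
  rw [← hid, abs_mul, abs_of_pos (two_pos : (0 : ℝ) < 2), integral_const_mul,
    integral_sub hI2 ((hI v hv 4 (by norm_num)).const_mul _), integral_const_mul] at hbd
  linarith

/-- The mean of the estimator built from i.i.d. isotropic directions deviates from the gradient by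
at most `ε`. -/
lemma norm_integral_centralQuotient_smul_sub_le (hq : IsometryInvariant q)
    [IsProbabilityMeasure q] (h8 : Integrable (fun u => ‖u‖ ^ 8) q) (hφ : ContDiff ℝ 2 φ)
    (hM : ∀ x y, ‖fderiv ℝ (gradient φ) x - fderiv ℝ (gradient φ) y‖ ≤ M * ‖x - y‖)
    (hν : 0 < ν) (x : Vec d) {δ ε : ℝ} (hδ : 0 ≤ δ) (hε : 0 ≤ ε)
    (h2 : ∀ v : Vec d, ‖v‖ = 1 → δ * ∫ u, inner ℝ v u ^ 2 ∂q = 1)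
    (hle : ∀ v : Vec d, ‖v‖ = 1 → δ * (M * ν ^ 2 / 2 *
        (∫ u, inner ℝ v u ^ 2 * ‖u‖ ^ 2 ∂q - 2 / 3 * ∫ u, inner ℝ v u ^ 4 ∂q)) ≤ ε) :
    ‖δ • ∫ u, centralQuotient ν φ x u • u ∂q - gradient φ x‖ ≤ ε := by
  have hI := (memLp_centralQuotient_smul (U := id) hφ hM hν h8 measurable_id x).integrable
      one_le_two
  set w := δ • ∫ u, centralQuotient ν φ x u • u ∂q - gradient φ x with hw
  rcases eq_or_ne w 0 with h0 | h0
  · simpa [h0] using hε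
  have hn : ‖w‖ ≠ 0 := norm_ne_zero_iff.2 h0
  -- Testing the error against its own direction recovers its norm, so bounds along unit vectors are
  -- enough.
  set v : Vec d := ‖w‖⁻¹ • w with hv
  have hv1 : ‖v‖ = 1 := by rw [hv, norm_smul, norm_inv, norm_norm, inv_mul_cancel₀ hn]
  have e1 : inner ℝ v w = ‖w‖ := by
    rw [hv, real_inner_smul_left, real_inner_self_eq_norm_sq]; field_simp
  have e2 : inner ℝ v w = δ * (∫ u, centralQuotient ν φ x u * inner ℝ v u ∂q
        - inner ℝ (gradient φ x) v * ∫ u, inner ℝ v u ^ 2 ∂q) := by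
    have h3 : inner ℝ v (∫ u, centralQuotient ν φ x u • u ∂q)
        = ∫ u, centralQuotient ν φ x u * inner ℝ v u ∂q := by
      rw [← integral_inner (by exact hI)]
      simp_rw [real_inner_smul_right]
    rw [hw, inner_sub_right, real_inner_smul_right, h3, real_inner_comm]
    linear_combination inner ℝ (gradient φ x) v * h2 v hv1
  rw [← e1, e2]
  have h4 := hq.abs_integral_centralQuotient_mul_inner_sub_le h8 hφ hM hν x hv1
  exact (mul_le_mul_of_nonneg_left ((le_abs_self _).trans h4) hδ).trans (hle v hv1)

end IsometryInvariant

lemma integrable_norm_pow_eight_pi {d N : ℕ} {q : Measure (Vec d)} [IsProbabilityMeasure q]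
    (h8 : Integrable (fun u => ‖u‖ ^ 8) q) (j : Fin N) :
    Integrable (fun u : Fin N → Vec d => ‖u j‖ ^ 8) (Measure.pi fun _ => q) :=
  integrable_comp_eval (μ := fun _ : Fin N => q) h8

/-- First and second moments of the estimator built from i.i.d. directions. -/
lemma integral_inner_sub_norm_sq_centralFD_pi {d N : ℕ} (hN : 0 < N) {φ : Vec d → ℝ} {M ν : ℝ}
    {q : Measure (Vec d)} [IsProbabilityMeasure q] (h8 : Integrable (fun u => ‖u‖ ^ 8) q)
    (hφ : ContDiff ℝ 2 φ)
    (hM : ∀ x y, ‖fderiv ℝ (gradient φ) x - fderiv ℝ (gradient φ) y‖ ≤ M * ‖x - y‖)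
    (hν : 0 < ν) (γ κ : ℝ) (x : Vec d) :
    ∫ u : Fin N → Vec d, (inner ℝ (gradient φ x) (centralFD γ ν φ u x)
        - κ * ‖centralFD γ ν φ u x‖ ^ 2) ∂(Measure.pi fun _ => q)
      = inner ℝ (gradient φ x) ((γ * N) • ∫ u, centralQuotient ν φ x u • u ∂q)
        - κ * (γ ^ 2 * N * ∫ u, (centralQuotient ν φ x u * ‖u‖) ^ 2 ∂q
          + (N - 1) / N * ‖(γ * N) • ∫ u, centralQuotient ν φ x u • u ∂q‖ ^ 2) := by
  have hY : MemLp (fun u => centralQuotient ν φ x u • u) 2 q :=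
    memLp_centralQuotient_smul (U := id) hφ hM hν h8 measurable_id x
  have hYm : Measurable fun u => centralQuotient ν φ x u • u :=
    (continuous_centralQuotient hφ.continuous x).measurable.smul measurable_id
  have hg := memLp_centralFD hφ hM hν (integrable_norm_pow_eight_pi (N := N) h8) γ x
  have hg1 := hg.integrable one_le_two
  rw [integral_sub (hg1.const_inner _) ((hg.integrable_norm_pow two_ne_zero).const_mul _),
    integral_inner hg1, integral_const_mul]
  have h1 : ∫ u : Fin N → Vec d, centralFD γ ν φ u x ∂(Measure.pi fun _ => q)
      = (γ * N) • ∫ u, centralQuotient ν φ x u • u ∂q := by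
    simp_rw [centralFD_eq]
    rw [integral_smul, integral_finsetSum _ fun j _ =>
      integrable_comp_eval (μ := fun _ : Fin N => q) (hY.integrable one_le_two)]
    have (j : Fin N) : ∫ u : Fin N → Vec d, centralQuotient ν φ x (u j) • u j
        ∂(Measure.pi fun _ => q) = ∫ u, centralQuotient ν φ x u • u ∂q :=
      integral_comp_eval (μ := fun _ : Fin N => q) hYm.aestronglyMeasurable
    simp_rw [this]
    simp [mul_smul, Nat.cast_smul_eq_nsmul]
  have h2 : ∫ u : Fin N → Vec d, ‖centralFD γ ν φ u x‖ ^ 2 ∂(Measure.pi fun _ => q)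
      = γ ^ 2 * N * ∫ u, (centralQuotient ν φ x u * ‖u‖) ^ 2 ∂q
          + (N - 1) / N * ‖(γ * N) • ∫ u, centralQuotient ν φ x u • u ∂q‖ ^ 2 := by
    simp_rw [centralFD_eq, norm_smul, mul_pow, Real.norm_eq_abs, sq_abs]
    rw [integral_const_mul, integral_norm_sum_sq_pi q hYm hY]
    simp_rw [norm_smul, mul_pow, Real.norm_eq_abs, sq_abs]
    have : (N : ℝ) ≠ 0 := by positivity
    field_simp
  rw [h1, h2]

/-- The descent estimate for i.i.d. isotropic directions, in terms of the moments of their law. -/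
lemma IsometryInvariant.le_integral_inner_sub_norm_sq_centralFD {d N : ℕ} (hd : 0 < d) (hN : 0 < N)
    {q : Measure (Vec d)} (hq : IsometryInvariant q) [IsProbabilityMeasure q]
    (h8 : Integrable (fun u => ‖u‖ ^ 8) q) {φ : Vec d → ℝ} {M ν : ℝ} (hφ : ContDiff ℝ 2 φ)
    (hM : ∀ x y, ‖fderiv ℝ (gradient φ) x - fderiv ℝ (gradient φ) y‖ ≤ M * ‖x - y‖)
    (hν : 0 < ν) (x : Vec d) {γ κ ε χ : ℝ} (hγ : 0 ≤ γ) (hκ : 0 ≤ κ) (hε : 0 ≤ ε)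
    (h2 : ∀ v : Vec d, ‖v‖ = 1 → γ * N * ∫ u, inner ℝ v u ^ 2 ∂q = 1)
    (hle : ∀ v : Vec d, ‖v‖ = 1 → γ * N * (M * ν ^ 2 / 2 *
        (∫ u, inner ℝ v u ^ 2 * ‖u‖ ^ 2 ∂q - 2 / 3 * ∫ u, inner ℝ v u ^ 4 ∂q)) ≤ ε)
    (hgrad : κ * (γ ^ 2 * N * (2 * (∫ u, ‖u‖ ^ 4 ∂q) / d) + 2 * (N - 1) / N) ≤ 1 / 4)
    (hχ : ε ^ 2 / 2 + κ * (γ ^ 2 * N * (2 * (M * ν ^ 2 / 6) ^ 2 * ∫ u, ‖u‖ ^ 8 ∂q)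
      + 2 * (N - 1) / N * ε ^ 2) ≤ χ) :
    ‖gradient φ x‖ ^ 2 / 4 - χ ≤
      ∫ u : Fin N → Vec d, (inner ℝ (gradient φ x) (centralFD γ ν φ u x)
        - κ * ‖centralFD γ ν φ u x‖ ^ 2) ∂(Measure.pi fun _ => q) := by
  have hN1 : (1 : ℝ) ≤ N := by exact_mod_cast hN
  have hd0 : (0 : ℝ) < d := by exact_mod_cast hd
  rw [integral_inner_sub_norm_sq_centralFD_pi hN h8 hφ hM hν]
  have hw := hq.norm_integral_centralQuotient_smul_sub_le h8 hφ hM hν x (by positivity) hε h2 hle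
  set w := (γ * N) • ∫ u, centralQuotient ν φ x u • u ∂q
  set G := gradient φ x
  have hi2 : Integrable (fun u => inner ℝ G u ^ 2 * ‖u‖ ^ 2) q :=
    integrable_inner_sq_mul_norm_sq (U := id) h8 measurable_id G
  have hsq : ∫ u, (centralQuotient ν φ x u * ‖u‖) ^ 2 ∂q ≤
      2 * (∫ u, ‖u‖ ^ 4 ∂q) / d * ‖G‖ ^ 2 + 2 * (M * ν ^ 2 / 6) ^ 2 * ∫ u, ‖u‖ ^ 8 ∂q := by
    have h1 := (memLp_centralQuotient_smul (U := id) hφ hM hν h8 measurable_id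
      x).integrable_norm_pow two_ne_zero
    simp only [id, norm_smul, mul_pow, Real.norm_eq_abs, sq_abs] at h1
    simp only [← mul_pow] at h1
    have hm := hq.integral_inner_sq_mul_norm_pow h8 G (l := 2) (by norm_num)
    have hm' : ∫ u, inner ℝ G u ^ 2 * ‖u‖ ^ 2 ∂q = (∫ u, ‖u‖ ^ 4 ∂q) / d * ‖G‖ ^ 2 := by
      field_simp; linarith
    calc ∫ u, (centralQuotient ν φ x u * ‖u‖) ^ 2 ∂q
        ≤ ∫ u, (2 * (inner ℝ G u ^ 2 * ‖u‖ ^ 2) + 2 * (M * ν ^ 2 / 6) ^ 2 * ‖u‖ ^ 8) ∂q :=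
          integral_mono h1 ((hi2.const_mul 2).add (h8.const_mul _))
            fun u => sq_centralQuotient_mul_norm_le hφ hM hν x u
      _ = _ := by
          rw [integral_add (hi2.const_mul 2) (h8.const_mul _), integral_const_mul,
            integral_const_mul, hm']
          ring
  have hGw : ‖G‖ ^ 2 - ‖G‖ * ε ≤ inner ℝ G w := by
    have h1 : inner ℝ G w = ‖G‖ ^ 2 + inner ℝ G (w - G) := by
      rw [inner_sub_right, real_inner_self_eq_norm_sq]; ring
    have h3 := (abs_le.1 (abs_real_inner_le_norm G (w - G))).1
    have h4 := mul_le_mul_of_nonneg_left hw (norm_nonneg G)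
    linarith
  have hw2 : ‖w‖ ^ 2 ≤ 2 * ‖G‖ ^ 2 + 2 * ε ^ 2 := by
    have h1 : ‖w‖ ≤ ‖G‖ + ε := by
      have := norm_add_le G (w - G)
      rw [add_sub_cancel] at this
      linarith
    nlinarith [norm_nonneg w, norm_nonneg G, sq_nonneg (‖G‖ - ε)]
  have hN' : (0 : ℝ) ≤ (N - 1) / N := div_nonneg (by linarith) (by linarith)
  have hA := mul_le_mul_of_nonneg_left
    (add_le_add (mul_le_mul_of_nonneg_left hsq (by positivity : 0 ≤ γ ^ 2 * N))
      (mul_le_mul_of_nonneg_left hw2 hN')) hκ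
  have hB := mul_le_mul_of_nonneg_right hgrad (sq_nonneg ‖G‖)
  have hC : 2 * ((N : ℝ) - 1) / N = 2 * ((N - 1) / N) := by ring
  rw [hC] at hB hχ
  -- `‖G‖ε ≤ (‖G‖² + ε²)/2` leaves `‖G‖²/2 - ε²/2` from the inner product. By `hgrad` the second
  -- moment consumes at most `‖G‖²/4` of this, and the terms free of `G` are collected by `hχ`.
  nlinarith [sq_nonneg (‖G‖ - ε)]

/-! ### The uniform distribution on the sphere -/

section Sphere

variable {d : ℕ}

/-- Expresses spherical measure by the volume of the cone over the set. Linear isometries commute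
with forming cones and preserve volume, which gives the invariance of the uniform law. -/
lemma map_toSphere_apply {s : Set (Vec d)} (hs : MeasurableSet s) :
    ((volume : Measure (Vec d)).toSphere).map Subtype.val s
      = d * volume (Set.image2 (fun (r : ℝ) (u : Vec d) => r • u) (Set.Ioo 0 1)
        (s ∩ Metric.sphere 0 1)) := by
  rw [Measure.map_apply measurable_subtype_coe hs,
    Measure.toSphere_apply' _ (measurable_subtype_coe hs), Subtype.image_preimage_coe,
    Set.inter_comm]
  simp [Set.image2_smul]

lemma isometryInvariant_uniformSphere : IsometryInvariant (uniformSphere d) := by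
  intro e
  rw [uniformSphere, Measure.map_smul]
  congr 1
  ext s hs
  have hem : Measurable e := e.continuous.measurable
  rw [Measure.map_apply hem hs, map_toSphere_apply (hem hs), map_toSphere_apply hs]
  congr 1
  refine Eq.trans ?_ (e.measurePreserving.measure_preimage_equiv (f := e.toMeasurableEquiv) _)
  congr 1
  ext y
  simp only [Set.mem_image2, Set.mem_preimage, Set.mem_inter_iff, mem_sphere_zero_iff_norm]
  constructor
  · rintro ⟨r, hr, u, ⟨hu, hn⟩, rfl⟩
    exact ⟨r, hr, e u, ⟨hu, by simpa using hn⟩, by simp⟩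
  · rintro ⟨r, hr, u, ⟨hu, hn⟩, h⟩
    refine ⟨r, hr, e.symm u, ⟨by simpa using hu, by simpa using hn⟩, ?_⟩
    apply e.injective
    simpa using h

lemma isProbabilityMeasure_uniformSphere (hd : 0 < d) :
    IsProbabilityMeasure (uniformSphere d) := by
  have : Nonempty (Fin d) := ⟨⟨0, hd⟩⟩
  refine ⟨?_⟩
  rw [uniformSphere, Measure.smul_apply, Measure.map_apply measurable_subtype_coe .univ,
    Set.preimage_univ, smul_eq_mul]
  refine ENNReal.inv_mul_cancel ?_ (measure_ne_top _ _)
  rw [Ne, Measure.measure_univ_eq_zero]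
  exact Measure.toSphere_ne_zero _

lemma ae_norm_eq_one_uniformSphere : ∀ᵐ u ∂uniformSphere d, ‖u‖ = 1 := by
  refine Measure.ae_smul_measure ?_ _
  rw [ae_map_iff measurable_subtype_coe.aemeasurable
    (measurableSet_eq_fun measurable_norm measurable_const)]
  exact Filter.Eventually.of_forall fun u => by simp

end Sphere

/-! ### Moments of the standard Gaussian distribution -/

lemma integrable_pow_gaussianReal (n : ℕ) :
    Integrable (fun t : ℝ => t ^ n) (gaussianReal 0 1) := by
  rcases Nat.eq_zero_or_pos n with rfl | hn
  · simp
  · refine ((IsGaussian.memLp_id (gaussianReal 0 1) n (by simp)).integrable_norm_pow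
      hn.ne').mono' (by fun_prop) (Filter.Eventually.of_forall fun t => ?_)
    simp

/-- Integration by parts: the density `ρ` satisfies `ρ' = -tρ`. -/
lemma integral_pow_add_two_gaussianReal (n : ℕ) :
    ∫ t : ℝ, t ^ (n + 2) ∂gaussianReal 0 1 = (n + 1) * ∫ t : ℝ, t ^ n ∂gaussianReal 0 1 := by
  have hder (t : ℝ) : HasDerivAt (gaussianPDFReal 0 1) (-t * gaussianPDFReal 0 1 t) t := by
    have h1 : HasDerivAt (fun t : ℝ => -(t - 0) ^ 2 / (2 * ((1 : NNReal) : ℝ))) (-t) t := by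
      have := (((hasDerivAt_id t).sub_const 0).pow 2).neg.div_const (2 * ((1 : NNReal) : ℝ))
      refine this.congr_deriv ?_
      simp [neg_div]
    have h2 := h1.exp.const_mul (√(2 * Real.pi * ((1 : NNReal) : ℝ)))⁻¹
    refine h2.congr_deriv ?_
    rw [gaussianPDFReal]; ring
  have hint (k : ℕ) : Integrable (fun t : ℝ => t ^ k * gaussianPDFReal 0 1 t) := by
    have h1 := integrable_pow_gaussianReal k
    rw [gaussianReal_of_var_ne_zero _ one_ne_zero,
      integrable_withDensity_iff_integrable_smul' (measurable_gaussianPDF 0 1)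
        (by simp [gaussianPDF])] at h1
    refine h1.congr (Filter.Eventually.of_forall fun t => ?_)
    simp [toReal_gaussianPDF, mul_comm]
  have hval (k : ℕ) : ∫ t : ℝ, t ^ k ∂gaussianReal 0 1
      = ∫ t : ℝ, t ^ k * gaussianPDFReal 0 1 t := by
    rw [integral_gaussianReal_eq_integral_smul one_ne_zero]
    simp [mul_comm]
  rw [hval, hval]
  have h := integral_mul_deriv_eq_deriv_mul_of_integrable (u := fun t : ℝ => t ^ (n + 1))
    (u' := fun t : ℝ => (n + 1) * t ^ n) (v := gaussianPDFReal 0 1)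
    (v' := fun t => -t * gaussianPDFReal 0 1 t)
    (fun t _ => (hasDerivAt_pow (n + 1) t).congr_deriv (by simp)) (fun t _ => hder t)
    ((hint (n + 2)).neg.congr (Filter.Eventually.of_forall fun t => by simp; ring))
    (((hint n).const_mul (n + 1)).congr (Filter.Eventually.of_forall fun t => by simp; ring))
    (hint (n + 1))
  have e1 : ∫ t : ℝ, t ^ (n + 1) * (-t * gaussianPDFReal 0 1 t)
      = -∫ t : ℝ, t ^ (n + 2) * gaussianPDFReal 0 1 t := by
    rw [← integral_neg]; congr with t; ring
  rw [e1, neg_inj] at h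
  rw [h, ← integral_const_mul]
  congr with t; ring

lemma integral_sq_gaussianReal : ∫ t : ℝ, t ^ 2 ∂gaussianReal 0 1 = 1 := by
  rw [integral_pow_add_two_gaussianReal 0]; simp

lemma integral_pow_four_gaussianReal : ∫ t : ℝ, t ^ 4 ∂gaussianReal 0 1 = 3 := by
  rw [integral_pow_add_two_gaussianReal 2, integral_sq_gaussianReal]; norm_num

lemma integral_pow_six_gaussianReal : ∫ t : ℝ, t ^ 6 ∂gaussianReal 0 1 = 15 := by
  rw [integral_pow_add_two_gaussianReal 4, integral_pow_four_gaussianReal]; norm_num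

lemma integral_pow_eight_gaussianReal : ∫ t : ℝ, t ^ 8 ∂gaussianReal 0 1 = 105 := by
  rw [integral_pow_add_two_gaussianReal 6, integral_pow_six_gaussianReal]; norm_num

/-- The first four moments of a chi-squared distribution. -/
lemma integral_sum_sq_pow_gaussian {ι : Type*} [Fintype ι] [DecidableEq ι] (s : Finset ι) :
    let π : Measure (ι → ℝ) := Measure.pi fun _ => gaussianReal 0 1
    let S : (ι → ℝ) → ℝ := fun t => ∑ i ∈ s, t i ^ 2
    (∀ k : ℕ, Integrable (fun t => S t ^ k) π) ∧
    ∫ t, S t ∂π = s.card ∧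
    ∫ t, S t ^ 2 ∂π = s.card * (s.card + 2) ∧
    ∫ t, S t ^ 3 ∂π = s.card * (s.card + 2) * (s.card + 4) ∧
    ∫ t, S t ^ 4 ∂π = s.card * (s.card + 2) * (s.card + 4) * (s.card + 6) := by
  intro π
  induction s using Finset.induction_on with
  | empty => simp
  | insert i s his ih =>
    obtain ⟨hI, h1, h2, h3, h4⟩ := ih
    set S : (ι → ℝ) → ℝ := fun t => ∑ i ∈ s, t i ^ 2
    -- The new coordinate is independent of the partial sum, so the binomial expansion turns each
    -- moment of the larger sum into products of Gaussian moments and moments from the induction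
    -- hypothesis. Integrability of all powers is carried along for this purpose.
    have hind : IndepFun (fun t : ι → ℝ => t i ^ 2) S π := by
      have h := (iIndepFun_pi (μ := fun _ : ι => gaussianReal 0 1)
        (X := fun _ (t : ℝ) => t ^ 2) fun _ => by fun_prop).indepFun_finsetSum_of_notMem
        (fun i => by fun_prop) his
      have e : (∑ j ∈ s, fun t : ι → ℝ => t j ^ 2) = S := by ext t; simp [S]
      rw [e] at h
      exact h.symm
    have hX (k : ℕ) : Integrable (fun t : ι → ℝ => (t i ^ 2) ^ k) π := by
      simp_rw [← pow_mul]
      exact integrable_comp_eval (μ := fun _ : ι => gaussianReal 0 1)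
        (integrable_pow_gaussianReal (2 * k))
    have hXv (k : ℕ) : ∫ t : ι → ℝ, (t i ^ 2) ^ k ∂π = ∫ t : ℝ, t ^ (2 * k) ∂gaussianReal 0 1 := by
      simp_rw [← pow_mul]
      exact integral_comp_eval (μ := fun _ : ι => gaussianReal 0 1) (f := fun t : ℝ => t ^ (2 * k))
        (by fun_prop)
    have hSm : Measurable S := by fun_prop
    have hprod (a b : ℕ) : Integrable (fun t : ι → ℝ => (t i ^ 2) ^ a * S t ^ b) π :=
      (hind.comp (measurable_id.pow_const a) (measurable_id.pow_const b)).integrable_mul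
        (hX a) (hI b)
    have hpv (a b : ℕ) : ∫ t : ι → ℝ, (t i ^ 2) ^ a * S t ^ b ∂π
        = (∫ t : ℝ, t ^ (2 * a) ∂gaussianReal 0 1) * ∫ t, S t ^ b ∂π := by
      rw [← hXv]
      exact (hind.comp (measurable_id.pow_const a)
        (measurable_id.pow_const b)).integral_mul_eq_mul_integral
        (hX a).aestronglyMeasurable (hI b).aestronglyMeasurable
    have hexp (k : ℕ) (t : ι → ℝ) : (∑ j ∈ insert i s, t j ^ 2) ^ k
        = ∑ m ∈ Finset.range (k + 1), (k.choose m : ℝ) * ((t i ^ 2) ^ m * S t ^ (k - m)) := by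
      rw [Finset.sum_insert his, add_pow]
      exact Finset.sum_congr rfl fun m _ => by ring
    have hval (k : ℕ) : ∫ t : ι → ℝ, (∑ j ∈ insert i s, t j ^ 2) ^ k ∂π
        = ∑ m ∈ Finset.range (k + 1), (k.choose m : ℝ) *
          ((∫ t : ℝ, t ^ (2 * m) ∂gaussianReal 0 1) * ∫ t, S t ^ (k - m) ∂π) := by
      simp_rw [hexp]
      rw [integral_finsetSum _ fun m _ => (hprod m (k - m)).const_mul _]
      simp_rw [integral_const_mul, hpv]
    have c31 : Nat.choose 3 1 = 3 := rfl
    have c41 : Nat.choose 4 1 = 4 := rfl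
    have c42 : Nat.choose 4 2 = 6 := rfl
    have g2 := integral_sq_gaussianReal
    have g4 := integral_pow_four_gaussianReal
    have g6 := integral_pow_six_gaussianReal
    have g8 := integral_pow_eight_gaussianReal
    refine ⟨fun k => ?_, ?_, ?_, ?_, ?_⟩
    · simp_rw [hexp]
      exact integrable_finsetSum _ fun m _ => (hprod m (k - m)).const_mul _
    · have := hval 1
      simp only [pow_one] at this
      rw [this, Finset.card_insert_of_notMem his]
      simp [Finset.sum_range_succ, h1, g2]
    · rw [hval 2, Finset.card_insert_of_notMem his]
      simp [Finset.sum_range_succ, h1, h2, g2, g4]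
      ring
    · rw [hval 3, Finset.card_insert_of_notMem his]
      simp [Finset.sum_range_succ, h1, h2, h3, g2, g4, g6, c31]
      ring
    · rw [hval 4, Finset.card_insert_of_notMem his]
      simp [Finset.sum_range_succ, h1, h2, h3, h4, g2, g4, g6, g8, c41, c42]
      ring

section StdGaussian

variable {d : ℕ}

lemma isometryInvariant_stdGaussian : IsometryInvariant (stdGaussian (Vec d)) :=
  fun e => stdGaussian_map e

lemma integrable_norm_pow_eight_stdGaussian :
    Integrable (fun u => ‖u‖ ^ 8) (stdGaussian (Vec d)) :=
  (IsGaussian.memLp_id (stdGaussian (Vec d)) 8 (by simp)).integrable_norm_pow (by norm_num)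

lemma integral_stdGaussian_eq {h : Vec d → ℝ} (hh : Continuous h) :
    ∫ u, h u ∂stdGaussian (Vec d)
      = ∫ t : Fin d → ℝ, h (WithLp.toLp 2 t) ∂(Measure.pi fun _ => gaussianReal 0 1) := by
  rw [← map_pi_eq_stdGaussian, integral_map (by fun_prop) hh.aestronglyMeasurable]

lemma integral_norm_sq_stdGaussian : ∫ u, ‖u‖ ^ 2 ∂stdGaussian (Vec d) = d := by
  have h := (integral_sum_sq_pow_gaussian (Finset.univ : Finset (Fin d))).2.1
  rw [integral_stdGaussian_eq (by fun_prop)]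
  simpa [EuclideanSpace.norm_sq_eq] using h

lemma integral_norm_pow_four_stdGaussian :
    ∫ u, ‖u‖ ^ 4 ∂stdGaussian (Vec d) = d * (d + 2) := by
  have h := (integral_sum_sq_pow_gaussian (Finset.univ : Finset (Fin d))).2.2.1
  rw [integral_stdGaussian_eq (by fun_prop)]
  have e (u : Vec d) : ‖u‖ ^ 4 = (‖u‖ ^ 2) ^ 2 := by ring
  simpa [e, EuclideanSpace.norm_sq_eq] using h

lemma integral_norm_pow_eight_stdGaussian :
    ∫ u, ‖u‖ ^ 8 ∂stdGaussian (Vec d) = d * (d + 2) * (d + 4) * (d + 6) := by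
  have h := (integral_sum_sq_pow_gaussian (Finset.univ : Finset (Fin d))).2.2.2.2
  rw [integral_stdGaussian_eq (by fun_prop)]
  have e (u : Vec d) : ‖u‖ ^ 8 = (‖u‖ ^ 2) ^ 4 := by ring
  simpa [e, EuclideanSpace.norm_sq_eq] using h

/-- By isometry invariance `v` may be taken to be a coordinate vector, which reduces the claim to
the real Gaussian. -/
lemma integral_inner_pow_four_stdGaussian (hd : 0 < d) {v : Vec d} (hv : ‖v‖ = 1) :
    ∫ u, inner ℝ v u ^ 4 ∂stdGaussian (Vec d) = 3 := by
  have h := isometryInvariant_stdGaussian.integral_inner_pow_mul_norm_pow_congr (v := v)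
    (w := EuclideanSpace.basisFun (Fin d) ℝ ⟨0, hd⟩) (by simp [hv]) 4 0
  simp only [pow_zero, mul_one] at h
  rw [h, integral_stdGaussian_eq (by fun_prop), ← integral_pow_four_gaussianReal]
  rw [← integral_comp_eval (μ := fun _ : Fin d => gaussianReal 0 1) (i := ⟨0, hd⟩)
    (f := fun t : ℝ => t ^ 4) (by fun_prop)]
  simp [EuclideanSpace.inner_single_left]

end StdGaussian

/-! ### Orthonormal directions -/

section Orthonormal

variable {d N : ℕ}

/-- The descent estimate for random orthonormal directions. -/
lemma le_integral_inner_sub_norm_sq_centralFD_of_orthonormal {Q : Measure (Fin N → Vec d)}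
    [IsProbabilityMeasure Q] (hon : ∀ᵐ u ∂Q, Orthonormal ℝ u) {φ : Vec d → ℝ} {M ν : ℝ}
    (hφ : ContDiff ℝ 2 φ)
    (hM : ∀ x y, ‖fderiv ℝ (gradient φ) x - fderiv ℝ (gradient φ) y‖ ≤ M * ‖x - y‖)
    (hν : 0 < ν) {γ κ : ℝ} (hγ : 0 ≤ γ) (hκ : κ * γ = 1) (hN : γ * N = d)
    (hsum : ∀ v : Vec d, γ * ∫ u, ∑ j, inner ℝ v (u j) ^ 2 ∂Q = ‖v‖ ^ 2) :
    (∀ j, Integrable (fun u => ‖u j‖ ^ 8) Q) ∧ ∀ x,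
    ‖gradient φ x‖ ^ 2 / 4 - Omega₂ d M ν ≤
      ∫ u, (inner ℝ (gradient φ x) (centralFD γ ν φ u x)
        - κ / 8 * ‖centralFD γ ν φ u x‖ ^ 2) ∂Q := by
  have h8 (j : Fin N) : Integrable (fun u : Fin N → Vec d => ‖u j‖ ^ 8) Q :=
    (integrable_const 1).congr (hon.mono fun u hu => by simp [hu.1 j])
  refine ⟨h8, fun x => ?_⟩
  set G := gradient φ x
  set ρ := M * ν ^ 2 / 6 with hρ
  have hg := memLp_centralFD hφ hM hν h8 γ x
  have hint : Integrable (fun u : Fin N → Vec d => inner ℝ G (centralFD γ ν φ u x)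
      - κ / 8 * ‖centralFD γ ν φ u x‖ ^ 2) Q :=
    ((hg.integrable one_le_two).const_inner _).sub
      ((hg.integrable_norm_pow two_ne_zero).const_mul _)
  have hI2 : Integrable (fun u : Fin N → Vec d => ∑ j, inner ℝ G (u j) ^ 2) Q := by
    refine integrable_finsetSum _ fun j _ =>
      Integrable.of_abs_le_norm_pow_eight (U := fun u : Fin N → Vec d => u j) (C := ‖G‖ ^ 2) (h8 j)
        (Measurable.aestronglyMeasurable (by fun_prop)) fun u => ?_
    rw [abs_pow]
    calc |inner ℝ G (u j)| ^ 2 ≤ (‖G‖ * ‖u j‖) ^ 2 := by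
          gcongr; exact abs_real_inner_le_norm _ _
      _ = ‖G‖ ^ 2 * ‖u j‖ ^ 2 := by ring
      _ ≤ _ := by gcongr; exact pow_le_one_add_pow_eight (norm_nonneg _) (by omega)
  have hpt : ∀ᵐ u ∂Q, γ / 4 * ∑ j, inner ℝ G (u j) ^ 2 - Omega₂ d M ν ≤
      inner ℝ G (centralFD γ ν φ u x) - κ / 8 * ‖centralFD γ ν φ u x‖ ^ 2 := by
    filter_upwards [hon] with u hu
    have e1 : inner ℝ G (centralFD γ ν φ u x)
        = γ * ∑ j, centralQuotient ν φ x (u j) * inner ℝ G (u j) := by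
      rw [centralFD_eq, real_inner_smul_right, inner_sum]
      simp_rw [real_inner_smul_right]
    -- Orthonormality removes the cross terms, so from here on each direction is treated separately.
    have e2 : ‖centralFD γ ν φ u x‖ ^ 2 = γ ^ 2 * ∑ j, centralQuotient ν φ x (u j) ^ 2 := by
      rw [centralFD_eq, norm_smul, mul_pow, Real.norm_eq_abs, sq_abs, ← real_inner_self_eq_norm_sq,
        hu.inner_sum]
      simp [sq]
    -- As `γ * N = d`, the quantity `Ω₂ = d M²ν⁴/48` gives each direction an allowance of `3/4 *
    -- ρ²`, with `ρ² = M²ν⁴/36`.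
    have e3 : Omega₂ d M ν = γ * ∑ _j : Fin N, 3 / 4 * ρ ^ 2 := by
      simp only [Finset.sum_const, Finset.card_univ, Fintype.card_fin, nsmul_eq_mul]
      rw [← mul_assoc, hN, Omega₂, hρ]; ring
    have e4 : κ / 8 * (γ ^ 2 * ∑ j, centralQuotient ν φ x (u j) ^ 2)
        = γ * ∑ j, centralQuotient ν φ x (u j) ^ 2 / 8 := by
      rw [← Finset.sum_div]
      linear_combination (γ / 8 * ∑ j, centralQuotient ν φ x (u j) ^ 2) * hκ
    rw [e1, e2, e3, e4, ← mul_sub, ← Finset.sum_sub_distrib,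
      show γ / 4 * ∑ j, inner ℝ G (u j) ^ 2 = γ * ∑ j, inner ℝ G (u j) ^ 2 / 4 by
        rw [← Finset.sum_div]; ring, ← mul_sub, ← Finset.sum_sub_distrib]
    refine mul_le_mul_of_nonneg_left (Finset.sum_le_sum fun j _ => ?_) hγ
    have h1 := abs_centralQuotient_sub_le hφ hM hν x (u j)
    rw [hu.1 j, one_pow, mul_one] at h1
    set c := centralQuotient ν φ x (u j)
    set a := inner ℝ G (u j)
    have h2 : (c - a) ^ 2 ≤ ρ ^ 2 := sq_le_sq' (abs_le.1 h1).1 (abs_le.1 h1).2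
    -- With `r = c - a` one has `ca - c²/8 - a²/4 = 5/8 (a + 3/5 r)² - 7/20 r²`, and `7/20 r² ≤ 3/4
    -- ρ²`.
    nlinarith [sq_nonneg (a + 3 / 5 * (c - a))]
  have hmono := integral_mono_ae ((hI2.const_mul (γ / 4)).sub (integrable_const _)) hint hpt
  have e5 : ∫ u : Fin N → Vec d, (γ / 4 * ∑ j, inner ℝ G (u j) ^ 2 - Omega₂ d M ν) ∂Q
      = ‖G‖ ^ 2 / 4 - Omega₂ d M ν := by
    rw [integral_sub (hI2.const_mul (γ / 4)) (integrable_const _), integral_const_mul]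
    simp
    linarith [hsum G]
  rw [← e5]
  exact hmono

/-- Parseval's identity: `d` orthonormal vectors in dimension `d` form a basis. -/
lemma sum_inner_sq_of_orthonormal {B : Fin d → Vec d} (hB : Orthonormal ℝ B) (v : Vec d) :
    ∑ i, inner ℝ v (B i) ^ 2 = ‖v‖ ^ 2 := by
  have hspan : ⊤ ≤ Submodule.span ℝ (Set.range B) :=
    (hB.linearIndependent.span_eq_top_of_card_eq_finrank' (by simp)).ge
  let b := OrthonormalBasis.mk hB hspan
  rw [← b.sum_sq_inner_left v]
  simp [b]

lemma measurableSet_orthonormal : MeasurableSet {u : Fin N → Vec d | Orthonormal ℝ u} := by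
  simp_rw [orthonormal_iff_ite, Set.ofPred_forall]
  exact MeasurableSet.iInter fun i => MeasurableSet.iInter fun j =>
    measurableSet_eq_fun (by fun_prop) measurable_const

lemma uniformIndices_set_nonempty (h : N ≤ d) :
    {σ : Fin N → Fin d | Function.Injective σ}.Nonempty :=
  ⟨Fin.castLE h, Fin.castLE_injective h⟩

lemma isProbabilityMeasure_uniformIndices (h : N ≤ d) :
    IsProbabilityMeasure (uniformIndices d N) :=
  isProbabilityMeasure_uniformOn (Set.toFinite _) (uniformIndices_set_nonempty h)

lemma ae_injective_uniformIndices :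
    ∀ᵐ σ ∂uniformIndices d N, Function.Injective σ := by
  rw [uniformIndices, uniformOn]
  exact ae_cond_mem (MeasurableSet.of_discrete)

/-- The law of indices drawn without replacement is invariant under permutations. -/
lemma integral_comp_perm_uniformIndices (τ : Equiv.Perm (Fin d)) (h : (Fin N → Fin d) → ℝ) :
    ∫ σ, h (τ ∘ σ) ∂uniformIndices d N = ∫ σ, h σ ∂uniformIndices d N := by
  have hmap : (uniformIndices d N).map (fun σ => τ ∘ σ) = uniformIndices d N := by
    ext s -
    rw [Measure.map_apply .of_discrete .of_discrete, uniformIndices, uniformOn,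
      cond_apply .of_discrete, cond_apply .of_discrete]
    congr 1
    let e : (Fin N → Fin d) ≃ (Fin N → Fin d) := Equiv.arrowCongr (Equiv.refl _) τ
    have h1 : {σ : Fin N → Fin d | Function.Injective σ} ∩ (fun σ => τ ∘ σ) ⁻¹' s
        = e ⁻¹' ({σ : Fin N → Fin d | Function.Injective σ} ∩ s) := by
      ext σ
      have : e σ = τ ∘ σ := rfl
      simp [this, τ.injective.of_comp_iff]
    rw [h1, Measure.count_apply .of_discrete, Measure.count_apply .of_discrete,
      Set.encard_preimage_of_bijective e.bijective]
  conv_rhs => rw [← hmap]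
  rw [integral_map (Measurable.of_discrete).aemeasurable
    (Measurable.of_discrete).aestronglyMeasurable]

/-- Each cyclic shift `i ↦ i + c` is a permutation, so it does not change the integral. Summed over
all `c`, the integrand becomes the constant `∑ i, w i`, whatever `σ j` is. -/
lemma integral_uniformIndices_apply (hd : 0 < d) (h : N ≤ d) (j : Fin N) (w : Fin d → ℝ) :
    d * ∫ σ, w (σ j) ∂uniformIndices d N = ∑ i, w i := by
  have := isProbabilityMeasure_uniformIndices h
  have : NeZero d := ⟨hd.ne'⟩
  have h1 (c : Fin d) : ∫ σ, w (σ j + c) ∂uniformIndices d N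
      = ∫ σ, w (σ j) ∂uniformIndices d N :=
    integral_comp_perm_uniformIndices (Equiv.addRight c) fun σ => w (σ j)
  have h2 : ∑ c : Fin d, ∫ σ, w (σ j + c) ∂uniformIndices d N = ∑ i, w i := by
    rw [← integral_finsetSum _ fun c _ => Integrable.of_finite]
    have (σ : Fin N → Fin d) : ∑ c, w (σ j + c) = ∑ i, w i :=
      Equiv.sum_comp (Equiv.addLeft (σ j)) w
    simp [this]
  simpa [h1] using h2

lemma measurable_frame_select :
    Measurable fun q : (Fin d → Vec d) × (Fin N → Fin d) => fun j => q.1 (q.2 j) :=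
  measurable_from_prod_countable_left fun σ => by
    exact measurable_pi_iff.2 fun j => measurable_pi_apply (σ j)

/-- Directions drawn without replacement from a random orthonormal basis. -/
lemma orthonormal_and_integral_of_frame (hd : 0 < d) (hN : 0 < N) (h : N ≤ d)
    (ρ : Measure (Fin d → Vec d)) [IsProbabilityMeasure ρ] (hρ : ∀ᵐ B ∂ρ, Orthonormal ℝ B) :
    (∀ᵐ u ∂(ρ.prod (uniformIndices d N)).map fun q j => q.1 (q.2 j), Orthonormal ℝ u) ∧
    ∀ v : Vec d, (d / N : ℝ) * ∫ u, ∑ j, inner ℝ v (u j) ^ 2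
      ∂(ρ.prod (uniformIndices d N)).map (fun q (j : Fin N) => q.1 (q.2 j)) = ‖v‖ ^ 2 := by
  have := isProbabilityMeasure_uniformIndices h
  have h1 : ∀ᵐ q ∂ρ.prod (uniformIndices d N), Orthonormal ℝ q.1 :=
    Measure.quasiMeasurePreserving_fst.ae hρ
  have h2 : ∀ᵐ q ∂ρ.prod (uniformIndices d N), Function.Injective q.2 :=
    Measure.quasiMeasurePreserving_snd.ae ae_injective_uniformIndices
  refine ⟨?_, fun v => ?_⟩
  · rw [ae_map_iff measurable_frame_select.aemeasurable measurableSet_orthonormal]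
    filter_upwards [h1, h2] with q hq1 hq2
    exact hq1.comp _ hq2
  · rw [integral_map measurable_frame_select.aemeasurable
      (Measurable.aestronglyMeasurable (by fun_prop))]
    have hm : Measurable fun q : (Fin d → Vec d) × (Fin N → Fin d) =>
        ∑ j, inner ℝ v (q.1 (q.2 j)) ^ 2 := by
      have : Measurable fun u : Fin N → Vec d => ∑ j, inner ℝ v (u j) ^ 2 := by fun_prop
      exact this.comp measurable_frame_select
    have hint : Integrable (fun q : (Fin d → Vec d) × (Fin N → Fin d) =>
        ∑ j, inner ℝ v (q.1 (q.2 j)) ^ 2) (ρ.prod (uniformIndices d N)) := by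
      refine (integrable_const (∑ _j : Fin N, ‖v‖ ^ 2)).mono' hm.aestronglyMeasurable ?_
      filter_upwards [h1] with q hq
      rw [Real.norm_eq_abs, abs_of_nonneg (Finset.sum_nonneg fun j _ => sq_nonneg _)]
      refine Finset.sum_le_sum fun j _ => ?_
      rw [← sq_abs]
      refine pow_le_pow_left₀ (abs_nonneg _) ?_ 2
      simpa [hq.1] using abs_real_inner_le_norm v (q.1 (q.2 j))
    rw [integral_prod _ hint]
    have h3 : ∀ᵐ B ∂ρ, ∫ σ : Fin N → Fin d, ∑ j, inner ℝ v (B (σ j)) ^ 2 ∂uniformIndices d N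
        = N / d * ‖v‖ ^ 2 := by
      filter_upwards [hρ] with B hB
      rw [integral_finsetSum _ fun j _ => Integrable.of_finite]
      have h4 (j : Fin N) : ∫ σ : Fin N → Fin d, inner ℝ v (B (σ j)) ^ 2 ∂uniformIndices d N
          = ‖v‖ ^ 2 / d := by
        have := integral_uniformIndices_apply hd h j fun i => inner ℝ v (B i) ^ 2
        rw [sum_inner_sq_of_orthonormal hB] at this
        field_simp
        linarith
      simp_rw [h4]
      simp; ring
    rw [integral_congr_ae h3]
    simp
    field_simp

end Orthonormal

/-! ### The five methods -/

/-- The ratio of the step size of a method and `Ω₁`. -/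
noncomputable def stepRatio (d N : ℕ) : FDMethod → ℝ
  | .cFD => 1
  | .cGS => (N : ℝ) / (N + 4.5 * d)
  | .cSS => (N : ℝ) / (N + 4.5 * d)
  | .cRC => (N : ℝ) / d
  | .cRS => (N : ℝ) / d

lemma stepSize_eq (d N : ℕ) (θ L : ℝ) (m : FDMethod) :
    stepSize d N θ L m = stepRatio d N m * Omega₁ θ L := by
  cases m <;> simp [stepSize, stepRatio]

lemma stepRatio_pos {d N : ℕ} (hd : 0 < d) (hN : 0 < N) (m : FDMethod) :
    0 < stepRatio d N m := by
  cases m <;> simp only [stepRatio] <;> positivity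

section Estimate

variable {d N : ℕ} {φ : Vec d → ℝ} {M ν : ℝ}

lemma nonneg_of_hessian_lipschitz (hd : 0 < d)
    (hM : ∀ x y, ‖fderiv ℝ (gradient φ) x - fderiv ℝ (gradient φ) y‖ ≤ M * ‖x - y‖) : 0 ≤ M := by
  have h := (norm_nonneg _).trans (hM (EuclideanSpace.basisFun (Fin d) ℝ ⟨0, hd⟩) 0)
  simpa using h

/-- The mixed moments are `E⟨v, u⟩²‖u‖² = d + 2` and `E⟨v, u⟩⁴ = 3`, so the bias bound is `Mν²/2 *
(d + 2 - 2/3 * 3) = Mν²/2 * d`. -/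
lemma cGS_estimate (hd : 0 < d) (hN : 0 < N) (hφ : ContDiff ℝ 2 φ)
    (hM : ∀ x y, ‖fderiv ℝ (gradient φ) x - fderiv ℝ (gradient φ) y‖ ≤ M * ‖x - y‖)
    (hν : 0 < ν) (x : Vec d) :
    ‖gradient φ x‖ ^ 2 / 4 - chiBar d N M ν .cGS ≤
      ∫ u : Fin N → Vec d, (inner ℝ (gradient φ x) (centralFD (1 / N) ν φ u x)
        - stepRatio d N .cGS / 8 * ‖centralFD (1 / N) ν φ u x‖ ^ 2)
        ∂(Measure.pi fun _ => stdGaussian (Vec d)) := by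
  have hM0 := nonneg_of_hessian_lipschitz hd hM
  have hN1 : (1 : ℝ) ≤ N := by exact_mod_cast hN
  have hd1 : (1 : ℝ) ≤ d := by exact_mod_cast hd
  have hN0 : (0 : ℝ) < N := by linarith
  have hd0 : (0 : ℝ) < d := by linarith
  have hq : IsometryInvariant (stdGaussian (Vec d)) := isometryInvariant_stdGaussian
  have h8 := integrable_norm_pow_eight_stdGaussian (d := d)
  have hm2 (v : Vec d) (hv : ‖v‖ = 1) : ∫ u, inner ℝ v u ^ 2 ∂stdGaussian (Vec d) = 1 := by
    have h := hq.integral_inner_sq_mul_norm_pow h8 v (l := 0) (by norm_num)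
    simp only [pow_zero, mul_one, hv, one_pow, one_mul, zero_add] at h
    rw [integral_norm_sq_stdGaussian] at h
    exact mul_left_cancel₀ hd0.ne' (h.trans (mul_one _).symm)
  have hm22 (v : Vec d) (hv : ‖v‖ = 1) :
      ∫ u, inner ℝ v u ^ 2 * ‖u‖ ^ 2 ∂stdGaussian (Vec d) = d + 2 := by
    have h := hq.integral_inner_sq_mul_norm_pow h8 v (l := 2) (by norm_num)
    simp only [hv, one_pow, one_mul, Nat.reduceAdd] at h
    rw [integral_norm_pow_four_stdGaussian] at h
    exact mul_left_cancel₀ hd0.ne' h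
  refine hq.le_integral_inner_sub_norm_sq_centralFD hd hN h8 hφ hM hν x (by positivity)
    (div_nonneg (stepRatio_pos hd hN .cGS).le (by norm_num)) (ε := M * ν ^ 2 / 2 * d)
    (by positivity) (fun v hv => ?_) (fun v hv => ?_) ?_ ?_
  · rw [hm2 v hv]; field_simp
  · rw [hm22 v hv, integral_inner_pow_four_stdGaussian hd hv]
    apply le_of_eq; field_simp; ring
  · rw [integral_norm_pow_four_stdGaussian, stepRatio]
    have e : (N : ℝ) / (N + 4.5 * d) / 8
        * ((1 / N) ^ 2 * N * (2 * (d * (d + 2)) / d) + 2 * (N - 1) / N)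
        = (d + 1 + N) / (4 * (N + 4.5 * d)) := by field_simp; ring
    -- What remains is `d + 1 ≤ 4.5 d`, true with room to spare since `d ≥ 1`.
    rw [e, div_le_iff₀ (by positivity)]
    linarith
  · rw [integral_norm_pow_eight_stdGaussian, stepRatio, chiBar, Omega₂]
    set c := ((d : ℝ) + 2) * (d + 4) * (d + 6) with hc
    have hc0 : 0 ≤ c := by positivity
    set W := M ^ 2 * ν ^ 4 with hW
    have hW0 : 0 ≤ W := by positivity
    have e1 : (M * ν ^ 2 / 2 * d) ^ 2 / 2 + (N : ℝ) / (N + 4.5 * d) / 8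
        * ((1 / N) ^ 2 * N * (2 * (M * ν ^ 2 / 6) ^ 2 * (d * (d + 2) * (d + 4) * (d + 6)))
          + 2 * (N - 1) / N * (M * ν ^ 2 / 2 * d) ^ 2)
        = (W * d) / (N + 4.5 * d) * (d / 8 * (N + 4.5 * d) + c / 144 + (N - 1) * d / 16) := by
      rw [hc, hW]; field_simp; ring
    have e2 : (72 * (N : ℝ) * d + 216 * d ^ 2 + c) / (2 * (N + 4.5 * d))
        * (d * M ^ 2 * ν ^ 4 / 48)
        = (W * d) / (N + 4.5 * d) * ((72 * (N : ℝ) * d + 216 * d ^ 2 + c) / 96) := by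
      rw [hW]; field_simp; ring
    rw [e1, e2]
    -- After the common factor is removed, the coefficients of `Nd`, `d²` and `c` are 3/16, 9/16 and
    -- 1/144 on the left against 3/4, 9/4 and 1/96 on the right.
    refine mul_le_mul_of_nonneg_left ?_ (by positivity)
    nlinarith [mul_pos hN0 hd0, mul_pos hd0 hd0]

/-- On the sphere all moments of the norm equal 1 and `E⟨v, u⟩² = 1/d`. The fourth moment enters the
bias with a negative sign and is dropped, which gives `ε = Mν²/2`. -/
lemma cSS_estimate (hd : 0 < d) (hN : 0 < N) (hφ : ContDiff ℝ 2 φ)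
    (hM : ∀ x y, ‖fderiv ℝ (gradient φ) x - fderiv ℝ (gradient φ) y‖ ≤ M * ‖x - y‖)
    (hν : 0 < ν) (h8 : Integrable (fun u => ‖u‖ ^ 8) (uniformSphere d)) (x : Vec d) :
    ‖gradient φ x‖ ^ 2 / 4 - chiBar d N M ν .cSS ≤
      ∫ u : Fin N → Vec d, (inner ℝ (gradient φ x) (centralFD (d / N) ν φ u x)
        - stepRatio d N .cSS / 8 * ‖centralFD (d / N) ν φ u x‖ ^ 2)
        ∂(Measure.pi fun _ => uniformSphere d) := by
  have := isProbabilityMeasure_uniformSphere hd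
  have hM0 := nonneg_of_hessian_lipschitz hd hM
  have hN1 : (1 : ℝ) ≤ N := by exact_mod_cast hN
  have hd1 : (1 : ℝ) ≤ d := by exact_mod_cast hd
  have hN0 : (0 : ℝ) < N := by linarith
  have hd0 : (0 : ℝ) < d := by linarith
  have hq : IsometryInvariant (uniformSphere d) := isometryInvariant_uniformSphere
  have hnorm (k : ℕ) : ∫ u, ‖u‖ ^ k ∂uniformSphere d = 1 := by
    rw [integral_congr_ae (g := fun _ => (1 : ℝ))
      (ae_norm_eq_one_uniformSphere.mono fun u hu => by simp [hu])]
    simp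
  have hm (l : ℕ) (hl : l ≤ 6) (v : Vec d) (hv : ‖v‖ = 1) :
      ∫ u, inner ℝ v u ^ 2 * ‖u‖ ^ l ∂uniformSphere d = 1 / d := by
    have h := hq.integral_inner_sq_mul_norm_pow h8 v hl
    rw [hnorm, hv] at h
    field_simp
    linarith
  have hm2 (v : Vec d) (hv : ‖v‖ = 1) : ∫ u, inner ℝ v u ^ 2 ∂uniformSphere d = 1 / d := by
    simpa using hm 0 (by norm_num) v hv
  refine hq.le_integral_inner_sub_norm_sq_centralFD hd hN h8 hφ hM hν x (by positivity)
    (div_nonneg (stepRatio_pos hd hN .cSS).le (by norm_num)) (ε := M * ν ^ 2 / 2)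
    (by positivity) (fun v hv => ?_) (fun v hv => ?_) ?_ ?_
  · rw [hm2 v hv]; field_simp
  · rw [hm 2 (by norm_num) v hv]
    have h4 : 0 ≤ ∫ u, inner ℝ v u ^ 4 ∂uniformSphere d :=
      integral_nonneg fun u => by positivity
    calc (d : ℝ) / N * N * (M * ν ^ 2 / 2 * (1 / d - 2 / 3 * ∫ u, inner ℝ v u ^ 4 ∂uniformSphere d))
        ≤ (d : ℝ) / N * N * (M * ν ^ 2 / 2 * (1 / d)) := by
          gcongr; linarith
      _ = M * ν ^ 2 / 2 := by field_simp
  · rw [hnorm, stepRatio]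
    have e : (N : ℝ) / (N + 4.5 * d) / 8
        * ((d / N) ^ 2 * N * (2 * 1 / d) + 2 * (N - 1) / N)
        = (d - 1 + N) / (4 * (N + 4.5 * d)) := by field_simp; ring
    rw [e, div_le_iff₀ (by positivity)]
    linarith
  · rw [hnorm, stepRatio, chiBar, Omega₂]
    set W := M ^ 2 * ν ^ 4 with hW
    have hW0 : 0 ≤ W := by positivity
    have e1 : (M * ν ^ 2 / 2) ^ 2 / 2 + (N : ℝ) / (N + 4.5 * d) / 8
        * ((d / N) ^ 2 * N * (2 * (M * ν ^ 2 / 6) ^ 2 * 1)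
          + 2 * (N - 1) / N * (M * ν ^ 2 / 2) ^ 2)
        = W / (N + 4.5 * d) * (1 / 8 * (N + 4.5 * d) + d ^ 2 / 144 + (N - 1) / 16) := by
      rw [hW]; field_simp; ring
    have e2 : (72 * (N : ℝ) + 216 * d + d ^ 2) / (2 * d * (N + 4.5 * d))
        * (d * M ^ 2 * ν ^ 4 / 48)
        = W / (N + 4.5 * d) * ((72 * (N : ℝ) + 216 * d + d ^ 2) / 96) := by
      rw [hW]; field_simp; ring
    rw [e1, e2]
    refine mul_le_mul_of_nonneg_left ?_ (by positivity)
    nlinarith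

/-- The moment bound and the descent estimate for the direction laws of the five methods. -/
theorem IsDirectionLaw.descent_estimate {m : FDMethod} {Q : Measure (Fin N → Vec d)}
    (hQ : IsDirectionLaw Q m) (hd : 0 < d) (hN : 0 < N) [IsProbabilityMeasure Q]
    (hφ : ContDiff ℝ 2 φ)
    (hM : ∀ x y, ‖fderiv ℝ (gradient φ) x - fderiv ℝ (gradient φ) y‖ ≤ M * ‖x - y‖)
    (hν : 0 < ν) :
    (∀ j, Integrable (fun u => ‖u j‖ ^ 8) Q) ∧ ∀ x,
    ‖gradient φ x‖ ^ 2 / 4 - chiBar d N M ν m ≤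
      ∫ u, (inner ℝ (gradient φ x) (centralFD (scaling d N m) ν φ u x)
        - stepRatio d N m / 8 * ‖centralFD (scaling d N m) ν φ u x‖ ^ 2) ∂Q := by
  have hd0 : (0 : ℝ) < d := by exact_mod_cast hd
  have hN0 : (0 : ℝ) < N := by exact_mod_cast hN
  cases m with
  | cFD =>
    obtain ⟨rfl, rfl⟩ := hQ
    have hb : Orthonormal ℝ fun j : Fin N => EuclideanSpace.basisFun (Fin N) ℝ (Fin.cast rfl j) :=
      (EuclideanSpace.basisFun (Fin N) ℝ).orthonormal
    refine le_integral_inner_sub_norm_sq_centralFD_of_orthonormal ?_ hφ hM hν zero_le_one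
      (mul_one 1) (one_mul _) fun v => ?_
    · rw [ae_dirac_iff measurableSet_orthonormal]; exact hb
    · rw [integral_dirac' _ _ (Measurable.stronglyMeasurable (by fun_prop))]
      refine (one_mul _).trans ?_
      exact sum_inner_sq_of_orthonormal hb v
  | cGS =>
    have hQ' : Q = Measure.pi fun _ => stdGaussian (Vec d) := hQ
    subst hQ'
    exact ⟨fun j => integrable_norm_pow_eight_pi integrable_norm_pow_eight_stdGaussian j,
      cGS_estimate hd hN hφ hM hν⟩
  | cSS =>
    have hQ' : Q = Measure.pi fun _ => uniformSphere d := hQ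
    subst hQ'
    have := isProbabilityMeasure_uniformSphere hd
    have h8 : Integrable (fun u => ‖u‖ ^ 8) (uniformSphere d) :=
      (integrable_const 1).congr (ae_norm_eq_one_uniformSphere.mono fun u hu => by simp [hu])
    exact ⟨fun j => integrable_norm_pow_eight_pi h8 j, cSS_estimate hd hN hφ hM hν h8⟩
  | cRC =>
    obtain ⟨h, rfl⟩ := hQ
    let b : Fin d → Vec d := EuclideanSpace.basisFun (Fin d) ℝ
    have := isProbabilityMeasure_uniformIndices h
    -- Random coordinates are the case of random subspaces in which the basis is deterministic, so
    -- its law is a Dirac mass.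
    have e : (uniformIndices d N).map (fun σ j => EuclideanSpace.basisFun (Fin d) ℝ (σ j))
        = ((Measure.dirac b).prod (uniformIndices d N)).map fun q (j : Fin N) => q.1 (q.2 j) := by
      rw [Measure.dirac_prod, Measure.map_map measurable_frame_select (by fun_prop)]
      rfl
    have hb : ∀ᵐ B ∂Measure.dirac b, Orthonormal ℝ B := by
      rw [ae_dirac_iff measurableSet_orthonormal]
      exact (EuclideanSpace.basisFun (Fin d) ℝ).orthonormal
    have hfr := orthonormal_and_integral_of_frame hd hN h _ hb
    rw [← e] at hfr
    exact le_integral_inner_sub_norm_sq_centralFD_of_orthonormal hfr.1 hφ hM hν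
      (by simp only [scaling]; positivity) (by simp only [scaling, stepRatio]; field_simp)
      (by simp only [scaling]; field_simp) hfr.2
  | cRS =>
    obtain ⟨h, ρ, hρ, hon, rfl⟩ := hQ
    have hfr := orthonormal_and_integral_of_frame hd hN h ρ hon
    exact le_integral_inner_sub_norm_sq_centralFD_of_orthonormal hfr.1 hφ hM hν
      (by simp only [scaling]; positivity) (by simp only [scaling, stepRatio]; field_simp)
      (by simp only [scaling]; field_simp) hfr.2

end Estimate

/-! ### Subsampled estimators -/

section Sampling

variable {d N : ℕ} {Ξ : Type*} [MeasurableSpace Ξ] {P : Measure Ξ} [IsProbabilityMeasure P]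
  {f : Vec d → Ξ → ℝ} {L M : ℝ}

omit [IsProbabilityMeasure P] in
lemma SmoothAssumption.measurable_uncurry (h : SmoothAssumption P f L M) :
    Measurable (Function.uncurry f) :=
  measurable_uncurry_of_continuous_of_measurable (u := f) (fun ζ => (h.contDiff ζ).continuous)
    h.measurable

omit [MeasurableSpace Ξ] in
lemma gST_eq_sum (f : Vec d → Ξ → ℝ) (γ ν : ℝ) {n : ℕ} (s : Fin n → Ξ) (u : Fin N → Vec d)
    (x : Vec d) :
    gST f γ ν s u x = (1 / (n : ℝ)) • ∑ i, centralFD γ ν (fun y => f y (s i)) u x := by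
  have h (j : Fin N) : centralQuotient ν (sampleAverage f s) x (u j)
      = (1 / (n : ℝ)) * ∑ i, centralQuotient ν (fun y => f y (s i)) x (u j) := by
    simp only [centralQuotient, sampleAverage]
    rw [← Finset.sum_div, Finset.sum_sub_distrib]
    ring
  simp only [gST, centralFD_eq, h, mul_smul, Finset.sum_smul]
  rw [← Finset.smul_sum, ← Finset.smul_sum, Finset.sum_comm, smul_comm]

lemma measurable_centralFD {φ : Vec d → ℝ} (hφ : Continuous φ) (γ ν : ℝ) (x : Vec d) :
    Measurable fun u : Fin N → Vec d => centralFD γ ν φ u x := by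
  have hc := continuous_centralQuotient (ν := ν) hφ x
  simp_rw [centralFD_eq]
  exact Continuous.measurable (by fun_prop)

lemma measurable_centralFD_sample (hf : Measurable (Function.uncurry f)) (γ ν : ℝ) (x : Vec d) :
    Measurable fun q : (Fin N → Vec d) × Ξ => centralFD γ ν (fun y => f y q.2) q.1 x := by
  simp_rw [centralFD_eq, centralQuotient]
  refine Measurable.const_smul (Finset.measurable_sum _ fun j _ => ?_) γ
  have hu : Measurable fun q : (Fin N → Vec d) × Ξ => q.1 j := by fun_prop
  have h1 : Measurable fun q : (Fin N → Vec d) × Ξ => f (x + ν • q.1 j) q.2 :=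
    hf.comp ((by fun_prop : Measurable fun q : (Fin N → Vec d) × Ξ => x + ν • q.1 j).prodMk
      measurable_snd)
  have h2 : Measurable fun q : (Fin N → Vec d) × Ξ => f (x - ν • q.1 j) q.2 :=
    hf.comp ((by fun_prop : Measurable fun q : (Fin N → Vec d) × Ξ => x - ν • q.1 j).prodMk
      measurable_snd)
  exact ((h1.sub h2).div_const _).smul hu

lemma measurable_gST_of_size (hf : Measurable (Function.uncurry f)) (γ ν : ℝ) (n : ℕ) :
    Measurable fun q : Vec d × ((Fin N → Vec d) × (ℕ → Ξ)) =>
      gST f γ ν (fun i : Fin n => q.2.2 i) q.2.1 q.1 := by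
  simp only [gST, centralFD, sampleAverage]
  refine Measurable.const_smul (Finset.measurable_sum _ fun j _ => ?_) γ
  have hu : Measurable fun q : Vec d × ((Fin N → Vec d) × (ℕ → Ξ)) => q.2.1 j :=
    (measurable_pi_apply j).comp (measurable_fst.comp measurable_snd)
  have hz (i : Fin n) : Measurable fun q : Vec d × ((Fin N → Vec d) × (ℕ → Ξ)) => q.2.2 i :=
    (measurable_pi_apply _).comp (measurable_snd.comp measurable_snd)
  have h1 : Measurable fun q : Vec d × ((Fin N → Vec d) × (ℕ → Ξ)) =>
      (1 / (n : ℝ)) * ∑ i : Fin n, f (q.1 + ν • q.2.1 j) (q.2.2 i) :=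
    (Finset.measurable_sum _ fun i _ =>
      hf.comp ((measurable_fst.add (hu.const_smul ν)).prodMk (hz i))).const_mul _
  have h2 : Measurable fun q : Vec d × ((Fin N → Vec d) × (ℕ → Ξ)) =>
      (1 / (n : ℝ)) * ∑ i : Fin n, f (q.1 - ν • q.2.1 j) (q.2.2 i) :=
    (Finset.measurable_sum _ fun i _ =>
      hf.comp ((measurable_fst.sub (hu.const_smul ν)).prodMk (hz i))).const_mul _
  exact ((h1.sub h2).div_const (2 * ν)).smul hu

/-- The estimator at `x` with directions `u` and the first `n` terms of the sequence `z` as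
samples. -/
noncomputable def prefixEstimator (f : Vec d → Ξ → ℝ) (γ ν : ℝ)
    (p : (Vec d × ℕ) × ((Fin N → Vec d) × (ℕ → Ξ))) : Vec d :=
  gST f γ ν (fun i : Fin p.1.2 => p.2.2 i) p.2.1 p.1.1

/-- The number of samples is itself an argument; as it takes countably many values, measurability
for each fixed value suffices. -/
lemma measurable_prefixEstimator (hf : Measurable (Function.uncurry f)) (γ ν : ℝ) :
    Measurable (prefixEstimator (N := N) f γ ν) := by
  have key : Measurable fun p : ℕ × (Vec d × ((Fin N → Vec d) × (ℕ → Ξ))) =>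
      prefixEstimator f γ ν ((p.2.1, p.1), p.2.2) :=
    measurable_from_prod_countable_right fun n => measurable_gST_of_size hf γ ν n
  have hm : Measurable fun p : (Vec d × ℕ) × ((Fin N → Vec d) × (ℕ → Ξ)) =>
      (p.1.2, (p.1.1, p.2)) :=
    (measurable_snd.comp measurable_fst).prodMk
      ((measurable_fst.comp measurable_fst).prodMk measurable_snd)
  have e : prefixEstimator (N := N) f γ ν
      = (fun p : ℕ × (Vec d × ((Fin N → Vec d) × (ℕ → Ξ))) =>
          prefixEstimator f γ ν ((p.2.1, p.1), p.2.2)) ∘ fun p => (p.1.2, (p.1.1, p.2)) := by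
    funext p; rfl
  rw [e]
  exact key.comp hm

omit [IsProbabilityMeasure P] in
lemma integrable_centralFD_sample (hint : ∀ x, Integrable (f x) P) (γ ν : ℝ) (u : Fin N → Vec d)
    (x : Vec d) : Integrable (fun ζ => centralFD γ ν (fun y => f y ζ) u x) P :=
  (integrable_finsetSum _ fun j _ =>
    (((hint (x + ν • u j)).sub (hint (x - ν • u j))).div_const (2 * ν)).smul_const (u j)).smul γ

omit [IsProbabilityMeasure P] in
lemma integral_centralFD_sample (hint : ∀ x, Integrable (f x) P) (γ ν : ℝ) (u : Fin N → Vec d)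
    (x : Vec d) :
    ∫ ζ, centralFD γ ν (fun y => f y ζ) u x ∂P = centralFD γ ν (objective P f) u x := by
  have h (j : Fin N) : Integrable
      (fun ζ => ((f (x + ν • u j) ζ - f (x - ν • u j) ζ) / (2 * ν)) • u j) P :=
    (((hint (x + ν • u j)).sub (hint (x - ν • u j))).div_const (2 * ν)).smul_const (u j)
  simp only [centralFD]
  rw [integral_smul, integral_finsetSum _ fun j _ => h j]
  congr 1
  refine Finset.sum_congr rfl fun j _ => ?_
  rw [integral_smul_const, integral_div, integral_sub (hint _) (hint _)]
  rfl

/-- Unbiasedness of sampling: central differences are linear in the function. In particular `g_T`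
does not depend on the positive sample size. -/
lemma gT_eq (hint : ∀ x, Integrable (f x) P) (γ ν : ℝ) {n : ℕ} (hn : 0 < n)
    (u : Fin N → Vec d) (x : Vec d) :
    gT P f γ ν n u x = centralFD γ ν (objective P f) u x := by
  have hI := integrable_centralFD_sample hint γ ν u x
  simp_rw [gT, gST_eq_sum]
  rw [integral_smul, integral_finsetSum _ fun i _ =>
    integrable_comp_eval (μ := fun _ : Fin n => P) hI]
  have (i : Fin n) : ∫ s : Fin n → Ξ, centralFD γ ν (fun y => f y (s i)) u x
      ∂(Measure.pi fun _ => P) = centralFD γ ν (objective P f) u x := by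
    rw [← integral_centralFD_sample hint]
    exact integral_comp_eval (μ := fun _ : Fin n => P) hI.aestronglyMeasurable
  simp_rw [this]
  have : (n : ℝ) ≠ 0 := by positivity
  simp [← Nat.cast_smul_eq_nsmul ℝ, smul_smul, this]

/-- Polynomial bound on the sampling error of the estimator. -/
lemma norm_sq_centralFD_sub_le (h : SmoothAssumption P f L M) {ν : ℝ} (hν : 0 < ν) (γ : ℝ)
    (x : Vec d) (u : Fin N → Vec d) (ζ : Ξ) :
    ‖centralFD γ ν (fun y => f y ζ) u x - centralFD γ ν (objective P f) u x‖ ^ 2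
      ≤ (γ ^ 2 * N * ∑ j, (1 + ‖u j‖ ^ 8)) *
        (2 * ‖gradient (fun y => f y ζ) x - gradient (objective P f) x‖ ^ 2
          + 2 * (L * ν) ^ 2) := by
  set F := objective P f with hF
  have hLF := (hasLipschitzGradHess_objective h).1
  have hf1 := (h.contDiff ζ).differentiable (by norm_num)
  have hF1 := h.contDiff_objective.differentiable (by norm_num)
  set H := gradient (fun y => f y ζ) x - gradient F x with hH
  set c : Fin N → ℝ := fun j =>
    centralQuotient ν (fun y => f y ζ) x (u j) - centralQuotient ν F x (u j) with hc
  have hcle (j : Fin N) : |c j| ≤ ‖H‖ * ‖u j‖ + L * ν * ‖u j‖ ^ 2 := by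
    have b1 := abs_sub_sub_inner_gradient_le hf1 (h.lipschitz ζ).1 x (ν • u j)
    have b2 := abs_sub_sub_inner_gradient_le hf1 (h.lipschitz ζ).1 x (-(ν • u j))
    have b3 := abs_sub_sub_inner_gradient_le hF1 hLF x (ν • u j)
    have b4 := abs_sub_sub_inner_gradient_le hF1 hLF x (-(ν • u j))
    have b5 := abs_real_inner_le_norm H (ν • u j)
    rw [hH, inner_sub_left] at b5
    rw [norm_neg, inner_neg_right, ← sub_eq_add_neg] at b2 b4
    have hn : ‖ν • u j‖ = ν * ‖u j‖ := by rw [norm_smul, Real.norm_eq_abs, abs_of_pos hν]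
    rw [← hF] at b3 b4
    rw [hn] at b1 b2 b3 b4 b5
    have e : c j = ((f (x + ν • u j) ζ - f (x - ν • u j) ζ) - (F (x + ν • u j) - F (x - ν • u j)))
        / (2 * ν) := by
      simp only [hc, centralQuotient]; ring
    rw [e, abs_div, abs_of_pos (by positivity : 0 < 2 * ν), div_le_iff₀ (by positivity)]
    rw [← hH] at b5
    simp only [abs_le] at *
    -- Four Taylor remainders of `L/2 * (ν‖u j‖)²` and two copies of `⟨H, ν u j⟩`, divided by `2ν`.
    constructor <;> linarith [b1.1, b1.2, b2.1, b2.2, b3.1, b3.2, b4.1, b4.2, b5.1, b5.2]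
  have e1 : centralFD γ ν (fun y => f y ζ) u x - centralFD γ ν F u x = γ • ∑ j, c j • u j := by
    rw [centralFD_eq, centralFD_eq, ← smul_sub, ← Finset.sum_sub_distrib]
    simp_rw [← sub_smul]
    rfl
  have e2 : ‖∑ j, c j • u j‖ ^ 2 ≤ N * ∑ j, (|c j| * ‖u j‖) ^ 2 := by
    have h1 : ‖∑ j, c j • u j‖ ≤ ∑ j, |c j| * ‖u j‖ :=
      (norm_sum_le _ _).trans (le_of_eq (by simp [norm_smul]))
    refine (pow_le_pow_left₀ (norm_nonneg _) h1 2).trans ?_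
    simpa using sq_sum_le_card_mul_sum_sq (s := Finset.univ) (f := fun j => |c j| * ‖u j‖)
  have e3 (j : Fin N) : (|c j| * ‖u j‖) ^ 2
      ≤ (1 + ‖u j‖ ^ 8) * (2 * ‖H‖ ^ 2 + 2 * (L * ν) ^ 2) := by
    have h4 := pow_le_one_add_pow_eight (norm_nonneg (u j)) (k := 4) (by norm_num)
    have h6 := pow_le_one_add_pow_eight (norm_nonneg (u j)) (k := 6) (by norm_num)
    calc (|c j| * ‖u j‖) ^ 2 ≤ ((‖H‖ * ‖u j‖ + L * ν * ‖u j‖ ^ 2) * ‖u j‖) ^ 2 := by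
          gcongr; exact hcle j
      _ ≤ 2 * ‖H‖ ^ 2 * ‖u j‖ ^ 4 + 2 * (L * ν) ^ 2 * ‖u j‖ ^ 6 := by
          nlinarith [sq_nonneg (‖H‖ * ‖u j‖ ^ 2 - L * ν * ‖u j‖ ^ 3)]
      _ ≤ 2 * ‖H‖ ^ 2 * (1 + ‖u j‖ ^ 8) + 2 * (L * ν) ^ 2 * (1 + ‖u j‖ ^ 8) := by gcongr
      _ = _ := by ring
  rw [e1, norm_smul, mul_pow, Real.norm_eq_abs, sq_abs]
  calc γ ^ 2 * ‖∑ j, c j • u j‖ ^ 2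
      ≤ γ ^ 2 * (N * ∑ j, (1 + ‖u j‖ ^ 8) * (2 * ‖H‖ ^ 2 + 2 * (L * ν) ^ 2)) := by
        refine mul_le_mul_of_nonneg_left (e2.trans ?_) (sq_nonneg γ)
        exact mul_le_mul_of_nonneg_left (Finset.sum_le_sum fun j _ => e3 j) (Nat.cast_nonneg N)
    _ = _ := by rw [← Finset.sum_mul]; ring

variable {Q : Measure (Fin N → Vec d)} [IsProbabilityMeasure Q]

lemma integrable_norm_sq_centralFD_sub (h : SmoothAssumption P f L M) {β₁ β₂ : ℝ}
    (hvar : BoundedGradVariance P f β₁ β₂) {ν : ℝ} (hν : 0 < ν) (γ : ℝ)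
    (h8 : ∀ j, Integrable (fun u => ‖u j‖ ^ 8) Q) (x : Vec d) :
    Integrable (fun q : (Fin N → Vec d) × Ξ =>
      ‖centralFD γ ν (fun y => f y q.2) q.1 x - centralFD γ ν (objective P f) q.1 x‖ ^ 2)
      (Q.prod P) := by
  have h1 : Integrable (fun u : Fin N → Vec d => γ ^ 2 * N * ∑ j, (1 + ‖u j‖ ^ 8)) Q :=
    (integrable_finsetSum _ fun j _ => (integrable_const 1).add (h8 j)).const_mul _
  have h2 : Integrable (fun ζ => 2 * ‖gradient (fun y => f y ζ) x - gradient (objective P f) x‖ ^ 2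
      + 2 * (L * ν) ^ 2) P := ((hvar.integrable x).const_mul 2).add (integrable_const _)
  have hm2 : Measurable fun q : (Fin N → Vec d) × Ξ => centralFD γ ν (objective P f) q.1 x := by
    exact (measurable_centralFD h.contDiff_objective.continuous γ ν x).comp measurable_fst
  refine (h1.mul_prod h2).mono' (((measurable_centralFD_sample h.measurable_uncurry γ ν x).sub
    hm2).norm.pow_const 2).aestronglyMeasurable (Filter.Eventually.of_forall fun q => ?_)
  rw [Real.norm_eq_abs, abs_of_nonneg (sq_nonneg _)]
  exact norm_sq_centralFD_sub_le h hν γ x q.1 q.2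

/-- Second moment of the estimator under the theoretical norm condition. -/
lemma integral_norm_sq_gST_le (h : SmoothAssumption P f L M) {β₁ β₂ : ℝ}
    (hvar : BoundedGradVariance P f β₁ β₂) {ν θ : ℝ} (hν : 0 < ν) (γ : ℝ)
    (h8 : ∀ j, Integrable (fun u => ‖u j‖ ^ 8) Q) (x : Vec d) {n : ℕ} (hn : 0 < n)
    {Z : Measure (ℕ → Ξ)} [IsProbabilityMeasure Z]
    (hZ : Z.map (fun z (i : Fin n) => z i) = Measure.pi fun _ => P)
    (hnc : NormCondition P f γ ν θ Q n x) :
    MemLp (fun w => prefixEstimator f γ ν ((x, n), w)) 2 (Q.prod Z) ∧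
    ∫ w, prefixEstimator f γ ν ((x, n), w) ∂Q.prod Z
      = ∫ u, centralFD γ ν (objective P f) u x ∂Q ∧
    ∫ w, ‖prefixEstimator f γ ν ((x, n), w)‖ ^ 2 ∂Q.prod Z
      ≤ (1 + θ ^ 2) * ∫ u, ‖centralFD γ ν (objective P f) u x‖ ^ 2 ∂Q := by
  set g : (Fin N → Vec d) → Vec d := fun u => centralFD γ ν (objective P f) u x with hg
  set Y : (Fin N → Vec d) → Ξ → Vec d := fun u ζ => centralFD γ ν (fun y => f y ζ) u x with hY
  have hYm : Measurable (Function.uncurry Y) :=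
    measurable_centralFD_sample h.measurable_uncurry γ ν x
  have hn0 : (n : ℝ) ≠ 0 := by positivity
  have hgL : MemLp g 2 Q :=
    memLp_centralFD h.contDiff_objective (hasLipschitzGradHess_objective h).2 hν h8 γ x
  have hgm : Measurable g := measurable_centralFD h.contDiff_objective.continuous γ ν x
  have hYI (u : Fin N → Vec d) : Integrable (Y u) P :=
    integrable_centralFD_sample h.integrable γ ν u x
  have hYE (u : Fin N → Vec d) : ∫ ζ, Y u ζ ∂P = g u :=
    integral_centralFD_sample h.integrable γ ν u x
  have hD2 : Integrable (fun q : (Fin N → Vec d) × Ξ => ‖Y q.1 q.2 - g q.1‖ ^ 2) (Q.prod P) :=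
    integrable_norm_sq_centralFD_sub h hvar hν γ h8 x
  have hYL : MemLp (Function.uncurry Y) 2 (Q.prod P) := by
    have hm : Measurable fun q : (Fin N → Vec d) × Ξ => Y q.1 q.2 - g q.1 :=
      hYm.sub (hgm.comp measurable_fst)
    have h1 : MemLp (fun q : (Fin N → Vec d) × Ξ => Y q.1 q.2 - g q.1) 2 (Q.prod P) :=
      (memLp_two_iff_integrable_sq_norm hm.aestronglyMeasurable).2 hD2
    have h2 := h1.add (hgL.comp_measurePreserving (measurePreserving_fst (μ := Q) (ν := P)))
    refine h2.ae_eq (Filter.Eventually.of_forall fun q => ?_)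
    simp [Function.uncurry]
  set K : (Fin N → Vec d) × (Fin n → Ξ) → Vec d := fun q => gST f γ ν q.2 q.1 x with hK
  have hGe (q : (Fin N → Vec d) × (Fin n → Ξ)) :
      K q = (1 / (n : ℝ)) • ∑ i, Y q.1 (q.2 i) := gST_eq_sum f γ ν q.2 q.1 x
  have hKE (u : Fin N → Vec d) : ∫ s, K (u, s) ∂(Measure.pi fun _ => P) = g u :=
    gT_eq h.integrable γ ν hn u x
  have hnc' : (∫ u, ∫ ζ, ‖Y u ζ - g u‖ ^ 2 ∂P ∂Q) / n ≤ θ ^ 2 * ∫ u, ‖g u‖ ^ 2 ∂Q := by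
    simpa only [NormCondition, gT_eq h.integrable γ ν hn] using hnc
  -- Only the first `n` samples enter, so integrals over the law `Z` of the whole sequence become
  -- integrals over `n` independent copies of `P`.
  let R : (ℕ → Ξ) → Fin n → Ξ := fun z i => z i
  have hpre : (fun w : (Fin N → Vec d) × (ℕ → Ξ) => prefixEstimator f γ ν ((x, n), w))
      = fun w => K (Prod.map id R w) := rfl
  rw [show (∫ w : (Fin N → Vec d) × (ℕ → Ξ), ‖prefixEstimator f γ ν ((x, n), w)‖ ^ 2 ∂Q.prod Z)
    = ∫ w, ‖K (Prod.map id R w)‖ ^ 2 ∂Q.prod Z from rfl, hpre]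
  clear_value Y g K
  have hR : MeasurePreserving R Z (Measure.pi fun _ => P) := ⟨by fun_prop, hZ⟩
  have hRp : MeasurePreserving (Prod.map id R) (Q.prod Z) (Q.prod (Measure.pi fun _ => P)) :=
    (MeasurePreserving.id Q).prod hR
  have hGL : MemLp K 2 (Q.prod (Measure.pi fun _ => P)) := by
    have mp (i : Fin n) : MeasurePreserving
        (fun q : (Fin N → Vec d) × (Fin n → Ξ) => (q.1, q.2 i))
        (Q.prod (Measure.pi fun _ => P)) (Q.prod P) :=
      (MeasurePreserving.id Q).prod (measurePreserving_eval (fun _ : Fin n => P) i)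
    have hsum : MemLp (fun q : (Fin N → Vec d) × (Fin n → Ξ) => ∑ i, Y q.1 (q.2 i)) 2
        (Q.prod (Measure.pi fun _ => P)) :=
      memLp_finsetSum _ fun i _ => hYL.comp_measurePreserving (mp i)
    exact (hsum.const_smul (1 / (n : ℝ))).ae_eq
      (Filter.Eventually.of_forall fun q => (hGe q).symm)
  have tr {E : Type} [NormedAddCommGroup E] [NormedSpace ℝ E]
      {k : (Fin N → Vec d) × (Fin n → Ξ) → E}
      (hk : AEStronglyMeasurable k (Q.prod (Measure.pi fun _ => P))) :
      ∫ w, k (Prod.map id R w) ∂Q.prod Z = ∫ q, k q ∂Q.prod (Measure.pi fun _ => P) := by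
    rw [← hRp.map_eq] at hk ⊢
    exact (integral_map hRp.measurable.aemeasurable hk).symm
  refine ⟨hGL.comp_measurePreserving hRp, ?_, ?_⟩
  · refine (tr hGL.aestronglyMeasurable).trans ?_
    rw [integral_prod _ (hGL.integrable one_le_two)]
    refine integral_congr_ae (Filter.Eventually.of_forall fun u => ?_)
    exact hKE u
  · refine (tr (hGL.integrable_norm_pow two_ne_zero).aestronglyMeasurable).trans_le ?_
    rw [integral_prod _ (hGL.integrable_norm_pow two_ne_zero)]
    -- Joint square integrability gives square integrability in `ζ` only for almost every `u`, which
    -- is enough inside the outer integral.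
    have hfib : ∀ᵐ u ∂Q, MemLp (Y u) 2 P := by
      have h1 : Integrable (fun q : (Fin N → Vec d) × Ξ => ‖Y q.1 q.2‖ ^ 2) (Q.prod P) :=
        hYL.integrable_norm_pow two_ne_zero
      filter_upwards [h1.prod_right_ae] with u hu
      rw [memLp_two_iff_integrable_sq_norm (hYI u).aestronglyMeasurable]
      exact hu
    -- Bias-variance decomposition for fixed directions. Integrated over `u`, the variance term is
    -- the left side of the norm condition.
    have hin : ∀ᵐ u ∂Q, ∫ s : Fin n → Ξ, ‖K (u, s)‖ ^ 2 ∂(Measure.pi fun _ => P)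
        = ‖g u‖ ^ 2 + (∫ ζ, ‖Y u ζ - g u‖ ^ 2 ∂P) / n := by
      filter_upwards [hfib] with u hu
      have hv : ∫ ζ, ‖Y u ζ - g u‖ ^ 2 ∂P = ∫ ζ, ‖Y u ζ‖ ^ 2 ∂P - ‖g u‖ ^ 2 := by
        have hi2 : Integrable (fun ζ => 2 * inner ℝ (g u) (Y u ζ)) P :=
          ((hYI u).const_inner _).const_mul 2
        have h1 (ζ : Ξ) : ‖Y u ζ - g u‖ ^ 2
            = (‖Y u ζ‖ ^ 2 - 2 * inner ℝ (g u) (Y u ζ)) + ‖g u‖ ^ 2 := by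
          rw [norm_sub_sq_real, real_inner_comm]
        have h2 : Integrable (fun ζ => ‖Y u ζ‖ ^ 2 - 2 * inner ℝ (g u) (Y u ζ)) P :=
          (hu.integrable_norm_pow two_ne_zero).sub hi2
        simp_rw [h1]
        rw [integral_add h2 (integrable_const _),
          integral_sub (hu.integrable_norm_pow two_ne_zero) hi2, integral_const_mul,
          integral_inner (hYI u), hYE, real_inner_self_eq_norm_sq]
        simp
        ring
      simp_rw [hGe, norm_smul, mul_pow, Real.norm_eq_abs, sq_abs]
      rw [integral_const_mul,
        integral_norm_sum_sq_pi P (Y := Y u) (hYm.comp measurable_prodMk_left) hu, hYE, hv]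
      field_simp
      ring
    rw [integral_congr_ae hin]
    have hDi : Integrable (fun u => ∫ ζ, ‖Y u ζ - g u‖ ^ 2 ∂P) Q := by
      simpa using hD2.integral_norm_prod_left
    rw [integral_add (hgL.integrable_norm_pow two_ne_zero) (hDi.div_const _), integral_div]
    have e : ∫ u, ‖centralFD γ ν (objective P f) u x‖ ^ 2 ∂Q = ∫ u, ‖g u‖ ^ 2 ∂Q := by rw [hg]
    rw [e]
    linarith

/-- Growth of the second moment of the exact estimator. -/
lemma integral_norm_sq_centralFD_le {φ : Vec d → ℝ} {M ν : ℝ} (hφ : ContDiff ℝ 2 φ)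
    (hM : ∀ x y, ‖fderiv ℝ (gradient φ) x - fderiv ℝ (gradient φ) y‖ ≤ M * ‖x - y‖)
    (hν : 0 < ν) (γ : ℝ) (h8 : ∀ j, Integrable (fun u => ‖u j‖ ^ 8) Q) (x : Vec d) :
    ∫ u, ‖centralFD γ ν φ u x‖ ^ 2 ∂Q ≤ (γ ^ 2 * N * ∫ u, ∑ j, (1 + ‖u j‖ ^ 8) ∂Q) *
      (2 * ‖gradient φ x‖ ^ 2 + 2 * (M * ν ^ 2 / 6) ^ 2) := by
  have hS : Integrable (fun u : Fin N → Vec d => ∑ j, (1 + ‖u j‖ ^ 8)) Q :=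
    integrable_finsetSum _ fun j _ => (integrable_const 1).add (h8 j)
  rw [← integral_const_mul, ← integral_mul_const]
  refine integral_mono ((memLp_centralFD hφ hM hν h8 γ x).integrable_norm_pow two_ne_zero)
    ((hS.const_mul _).mul_const _) fun u => ?_
  simp only
  rw [centralFD_eq, norm_smul, mul_pow, Real.norm_eq_abs, sq_abs, mul_assoc, mul_assoc]
  refine mul_le_mul_of_nonneg_left ?_ (sq_nonneg γ)
  have h1 : ‖∑ j, centralQuotient ν φ x (u j) • u j‖
      ≤ ∑ j, |centralQuotient ν φ x (u j)| * ‖u j‖ :=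
    (norm_sum_le _ _).trans (le_of_eq (by simp [norm_smul]))
  refine (pow_le_pow_left₀ (norm_nonneg _) h1 2).trans ?_
  have h2 := sq_sum_le_card_mul_sum_sq (s := Finset.univ)
    (f := fun j => |centralQuotient ν φ x (u j)| * ‖u j‖)
  rw [Finset.card_univ, Fintype.card_fin] at h2
  refine h2.trans (mul_le_mul_of_nonneg_left ?_ (Nat.cast_nonneg N))
  rw [Finset.sum_mul]
  refine Finset.sum_le_sum fun j _ => ?_
  rw [mul_pow, sq_abs, ← mul_pow]
  have h3 : inner ℝ (gradient φ x) (u j) ^ 2 ≤ (‖gradient φ x‖ * ‖u j‖) ^ 2 := by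
    rw [← sq_abs]; gcongr; exact abs_real_inner_le_norm _ _
  have h4 := pow_le_one_add_pow_eight (norm_nonneg (u j)) (k := 4) (by norm_num)
  calc (centralQuotient ν φ x (u j) * ‖u j‖) ^ 2
      ≤ 2 * (inner ℝ (gradient φ x) (u j) ^ 2 * ‖u j‖ ^ 2)
        + 2 * (M * ν ^ 2 / 6) ^ 2 * ‖u j‖ ^ 8 := sq_centralQuotient_mul_norm_le hφ hM hν x (u j)
    _ ≤ 2 * ((‖gradient φ x‖ * ‖u j‖) ^ 2 * ‖u j‖ ^ 2)
        + 2 * (M * ν ^ 2 / 6) ^ 2 * (1 + ‖u j‖ ^ 8) := by gcongr; linarith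
    _ = 2 * ‖gradient φ x‖ ^ 2 * ‖u j‖ ^ 4 + 2 * (M * ν ^ 2 / 6) ^ 2 * (1 + ‖u j‖ ^ 8) := by ring
    _ ≤ 2 * ‖gradient φ x‖ ^ 2 * (1 + ‖u j‖ ^ 8)
        + 2 * (M * ν ^ 2 / 6) ^ 2 * (1 + ‖u j‖ ^ 8) := by gcongr
    _ = _ := by ring

end Sampling

/-! ### One step of the iteration -/

/-- Fubini's theorem for a function of two independent random variables. -/
lemma integrable_and_integral_of_indepFun {Ω A B : Type*} [MeasurableSpace Ω] [MeasurableSpace A]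
    [MeasurableSpace B] {μ : Measure Ω} [IsProbabilityMeasure μ] {X : Ω → A} {W : Ω → B}
    (hX : Measurable X) (hW : Measurable W) (hind : IndepFun X W μ) {h : A × B → ℝ}
    (hm : Measurable h) (h1 : ∀ᵐ ω ∂μ, Integrable (fun w => h (X ω, w)) (μ.map W))
    (h2 : Integrable (fun ω => ∫ w, ‖h (X ω, w)‖ ∂μ.map W) μ) :
    Integrable (fun ω => h (X ω, W ω)) μ ∧
      Integrable (fun ω => ∫ w, h (X ω, w) ∂μ.map W) μ ∧
      ∫ ω, h (X ω, W ω) ∂μ = ∫ ω, ∫ w, h (X ω, w) ∂μ.map W ∂μ := by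
  have hXp := Measure.isProbabilityMeasure_map (μ := μ) hX.aemeasurable
  have hWp := Measure.isProbabilityMeasure_map (μ := μ) hW.aemeasurable
  have hmap := (indepFun_iff_map_prod_eq_prod_map_map hX.aemeasurable hW.aemeasurable).1 hind
  have hXW : Measurable fun ω => (X ω, W ω) := hX.prodMk hW
  have hint : Integrable h ((μ.map X).prod (μ.map W)) := by
    rw [integrable_prod_iff hm.aestronglyMeasurable]
    refine ⟨?_, ?_⟩
    · exact (ae_map_iff hX.aemeasurable
        (p := fun a => Integrable (fun w => h (a, w)) (μ.map W))
        (measurableSet_integrable (f := fun a w => h (a, w)) hm.stronglyMeasurable)).2 h1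
    · have hs : StronglyMeasurable fun a => ∫ w, ‖h (a, w)‖ ∂μ.map W :=
        hm.stronglyMeasurable.norm.integral_prod_right'
      exact (integrable_map_measure hs.aestronglyMeasurable hX.aemeasurable).2 h2
  have hs : StronglyMeasurable fun a => ∫ w, h (a, w) ∂μ.map W :=
    hm.stronglyMeasurable.integral_prod_right'
  refine ⟨?_, ?_, ?_⟩
  · rw [← hmap] at hint
    exact (integrable_map_measure hm.aestronglyMeasurable hXW.aemeasurable).1 hint
  · exact h2.mono' (hs.comp_measurable hX).aestronglyMeasurable
      (Filter.Eventually.of_forall fun ω => norm_integral_le_integral_norm _)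
  · rw [← integral_map hXW.aemeasurable hm.aestronglyMeasurable, hmap, integral_prod _ hint,
      integral_map hX.aemeasurable hs.aestronglyMeasurable]

/-- A function with an `L`-Lipschitz gradient that is bounded below satisfies
`‖∇φ‖² ≤ 2L(φ - inf φ)`. -/
lemma norm_sq_gradient_le {d : ℕ} {φ : Vec d → ℝ} {L : ℝ} (hL : 0 < L) (h : Differentiable ℝ φ)
    (hlip : ∀ x y, ‖gradient φ x - gradient φ y‖ ≤ L * ‖x - y‖)
    (hbdd : BddBelow (Set.range φ)) (x : Vec d) :
    ‖gradient φ x‖ ^ 2 ≤ 2 * L * (φ x - ⨅ y, φ y) := by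
  set G := gradient φ x
  -- A gradient step of length `1/L` lowers `φ` by at least `‖G‖²/(2L)`, yet cannot go below the
  -- infimum.
  have h1 := abs_sub_sub_inner_gradient_le h hlip x (-(L⁻¹ • G))
  have h2 := ciInf_le hbdd (x + -(L⁻¹ • G))
  rw [inner_neg_right, real_inner_smul_right, real_inner_self_eq_norm_sq, norm_neg, norm_smul,
    Real.norm_eq_abs, abs_of_pos (inv_pos.2 hL)] at h1
  have h3 := (abs_le.1 h1).2
  have e : L / 2 * (L⁻¹ * ‖G‖) ^ 2 = L⁻¹ * ‖G‖ ^ 2 / 2 := by field_simp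
  rw [e] at h3
  have h4 : L⁻¹ * ‖G‖ ^ 2 ≤ 2 * (φ x - ⨅ y, φ y) := by linarith
  rw [inv_mul_le_iff₀ hL] at h4
  linarith

section Step

variable {d N : ℕ} {Ξ : Type*} [MeasurableSpace Ξ] {P : Measure Ξ} [IsProbabilityMeasure P]
  {f : Vec d → Ξ → ℝ} {Lf Mf β₁ β₂ LF MF ν θ : ℝ}

omit [IsProbabilityMeasure P] in
-- Through `‖∇F‖² ≤ 2L(F - inf F)`, the induction along the iterates has to carry only the
-- integrability of the objective.
lemma integrable_norm_sq_gradient_comp (hsmooth : SmoothAssumption P f Lf Mf) (hLF : 0 < LF)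
    (hF : HasLipschitzGradHess (objective P f) LF MF) {Ω : Type*} [MeasurableSpace Ω]
    {μ : Measure Ω} [IsProbabilityMeasure μ] {X : Ω → Vec d} (hX : Measurable X)
    (hFX : Integrable (fun ω => objective P f (X ω)) μ) :
    Integrable (fun ω => ‖gradient (objective P f) (X ω)‖ ^ 2) μ := by
  have hg := (contDiff_gradient hsmooth.contDiff_objective).continuous.measurable
  refine ((hFX.sub (integrable_const (⨅ y, objective P f y))).const_mul (2 * LF)).mono'
    (((hg.comp hX).norm.pow_const 2).aestronglyMeasurable) (Filter.Eventually.of_forall fun ω => ?_)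
  rw [Real.norm_eq_abs, abs_of_nonneg (sq_nonneg _)]
  exact norm_sq_gradient_le hLF (hsmooth.contDiff_objective.differentiable (by norm_num)) hF.1
    hsmooth.bddBelow (X ω)

/-- The expected decrease of the objective in one step. -/
theorem expected_descent (hd : 0 < d) (hN : 0 < N) (hsmooth : SmoothAssumption P f Lf Mf)
    (hvar : BoundedGradVariance P f β₁ β₂) (hLF : 0 < LF)
    (hF : HasLipschitzGradHess (objective P f) LF MF) (m : FDMethod) (hν : 0 < ν)
    {Ω : Type*} [MeasurableSpace Ω] {μ : Measure Ω} [IsProbabilityMeasure μ]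
    {T : Ω → Fin N → Vec d} {ζ : ℕ → Ω → Ξ} {X : Ω → Vec d} {n : Ω → ℕ}
    (hT : Measurable T) (hζ : ∀ i, Measurable (ζ i)) (hX : Measurable X) (hn : Measurable n)
    (hlaw : IsDirectionLaw (μ.map T) m) (hζlaw : ∀ i, μ.map (ζ i) = P) (hζind : iIndepFun ζ μ)
    (hTζ : IndepFun T (fun ω i => ζ i ω) μ)
    (hind : IndepFun (fun ω => (X ω, n ω)) (fun ω => (T ω, fun i => ζ i ω)) μ)
    (hpos : ∀ ω, 0 < n ω)
    (hnc : ∀ᵐ ω ∂μ, NormCondition P f (scaling d N m) ν θ (μ.map T) (n ω) (X ω))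
    (hFX : Integrable (fun ω => objective P f (X ω)) μ) :
    let X' : Ω → Vec d := fun ω => X ω - stepSize d N θ LF m •
      prefixEstimator f (scaling d N m) ν ((X ω, n ω), (T ω, fun i => ζ i ω))
    Integrable (fun ω => objective P f (X' ω)) μ ∧
    ∫ ω, objective P f (X' ω) ∂μ ≤ ∫ ω, objective P f (X ω) ∂μ - stepSize d N θ LF m *
      ((∫ ω, ‖gradient (objective P f) (X ω)‖ ^ 2 ∂μ) / 4 - chiBar d N MF ν m) := by
  intro X'
  set F := objective P f with hFdef
  set α := stepSize d N θ LF m with hα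
  set γ := scaling d N m
  set κ := stepRatio d N m with hκ
  set Q := μ.map T with hQdef
  have hQp : IsProbabilityMeasure Q := Measure.isProbabilityMeasure_map hT.aemeasurable
  have hζm : Measurable fun ω i => ζ i ω := measurable_pi_iff.2 hζ
  set Z : Measure (ℕ → Ξ) := μ.map fun ω i => ζ i ω with hZdef
  have hZp : IsProbabilityMeasure Z := Measure.isProbabilityMeasure_map hζm.aemeasurable
  have hF2 : ContDiff ℝ 2 F := hsmooth.contDiff_objective
  have hF1 : Differentiable ℝ F := hF2.differentiable (by norm_num)
  have hFm : Measurable F := hF2.continuous.measurable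
  have hgm : Measurable (gradient F) := (contDiff_gradient hF2).continuous.measurable
  obtain ⟨h8, hest⟩ := hlaw.descent_estimate hd hN hF2 hF.2 hν
  have hW : μ.map (fun ω => (T ω, fun i => ζ i ω)) = Q.prod Z :=
    (indepFun_iff_map_prod_eq_prod_map_map hT.aemeasurable hζm.aemeasurable).1 hTζ
  have hWm : Measurable fun ω => (T ω, fun i => ζ i ω) := hT.prodMk hζm
  have hXn : Measurable fun ω => (X ω, n ω) := hX.prodMk hn
  -- An independent sequence with common law `P` has product law on its first `k` terms, for every
  -- possible sample size `k`.
  have hZpi (k : ℕ) : Z.map (fun z (i : Fin k) => z i) = Measure.pi fun _ => P := by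
    rw [hZdef, Measure.map_map (by fun_prop) hζm]
    have h1 := (iIndepFun_iff_map_fun_eq_pi_map (fun i : Fin k => (hζ i).aemeasurable)).1
      (hζind.precomp Fin.val_injective)
    simp only [hζlaw] at h1
    exact h1
  have hG2 : Integrable (fun ω => ‖gradient F (X ω)‖ ^ 2) μ :=
    integrable_norm_sq_gradient_comp hsmooth hLF hF hX hFX
  set g := prefixEstimator (N := N) f γ ν with hg
  have hgmeas : Measurable g := measurable_prefixEstimator hsmooth.measurable_uncurry γ ν
  have hcond : ∀ᵐ ω ∂μ, MemLp (fun w => g ((X ω, n ω), w)) 2 (Q.prod Z) ∧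
      ∫ w, g ((X ω, n ω), w) ∂Q.prod Z = ∫ u, centralFD γ ν F u (X ω) ∂Q ∧
      ∫ w, ‖g ((X ω, n ω), w)‖ ^ 2 ∂Q.prod Z
        ≤ (1 + θ ^ 2) * ∫ u, ‖centralFD γ ν F u (X ω)‖ ^ 2 ∂Q :=
    hnc.mono fun ω hω =>
      integral_norm_sq_gST_le hsmooth hvar hν γ h8 (X ω) (hpos ω) (hZpi (n ω)) hω
  set A : ℝ := γ ^ 2 * N * ∫ u, ∑ j, (1 + ‖u j‖ ^ 8) ∂Q with hA
  have hgrow (y : Vec d) : ∫ u, ‖centralFD γ ν F u y‖ ^ 2 ∂Q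
      ≤ A * (2 * ‖gradient F y‖ ^ 2 + 2 * (MF * ν ^ 2 / 6) ^ 2) :=
    integral_norm_sq_centralFD_le hF2 hF.2 hν γ h8 y
  have hbound : Integrable (fun ω => (1 + θ ^ 2) *
      (A * (2 * ‖gradient F (X ω)‖ ^ 2 + 2 * (MF * ν ^ 2 / 6) ^ 2))) μ :=
    (((hG2.const_mul 2).add (integrable_const _)).const_mul A).const_mul _
  have hsqm : Measurable fun p => ‖g p‖ ^ 2 := hgmeas.norm.pow_const 2
  have hinm : Measurable fun p : (Vec d × ℕ) × ((Fin N → Vec d) × (ℕ → Ξ)) =>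
      inner ℝ (gradient F p.1.1) (g p) :=
    (hgm.comp (measurable_fst.comp measurable_fst)).inner hgmeas
  have hsqb : ∀ᵐ ω ∂μ, ∫ w, ‖g ((X ω, n ω), w)‖ ^ 2 ∂Q.prod Z ≤ (1 + θ ^ 2) *
      (A * (2 * ‖gradient F (X ω)‖ ^ 2 + 2 * (MF * ν ^ 2 / 6) ^ 2)) :=
    hcond.mono fun ω hω => hω.2.2.trans
      (mul_le_mul_of_nonneg_left (hgrow (X ω)) (by positivity))
  obtain ⟨hsqI, hfibS, hsqE⟩ := integrable_and_integral_of_indepFun hXn hWm hind hsqm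
    (by rw [hW]; exact hcond.mono fun ω hω => hω.1.integrable_norm_pow two_ne_zero)
    (by
      rw [hW]
      refine hbound.mono' ?_ ?_
      · exact (hsqm.stronglyMeasurable.norm.integral_prod_right'.comp_measurable
          hXn).aestronglyMeasurable
      · filter_upwards [hsqb] with ω hω
        rw [Real.norm_eq_abs, abs_of_nonneg (integral_nonneg fun w => norm_nonneg _)]
        simpa using hω)
  have hin1 (ω : Ω) (hω : MemLp (fun w => g ((X ω, n ω), w)) 2 (Q.prod Z)) :
      Integrable (fun w => inner ℝ (gradient F (X ω)) (g ((X ω, n ω), w))) (Q.prod Z) :=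
    (hω.integrable one_le_two).const_inner _
  obtain ⟨hinI, hfibI, hinE⟩ := integrable_and_integral_of_indepFun hXn hWm hind hinm
    (by rw [hW]; exact hcond.mono fun ω hω => hin1 ω hω.1)
    (by
      rw [hW]
      refine (hG2.add hbound).mono' ?_ ?_
      · exact (hinm.stronglyMeasurable.norm.integral_prod_right'.comp_measurable
          hXn).aestronglyMeasurable
      · filter_upwards [hsqb, hcond] with ω hω hω'
        rw [Real.norm_eq_abs, abs_of_nonneg (integral_nonneg fun w => norm_nonneg _)]
        have hI2 := hω'.1.integrable_norm_pow two_ne_zero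
        calc ∫ w, ‖inner ℝ (gradient F (X ω)) (g ((X ω, n ω), w))‖ ∂Q.prod Z
            ≤ ∫ w, (‖gradient F (X ω)‖ ^ 2 + ‖g ((X ω, n ω), w)‖ ^ 2) ∂Q.prod Z := by
              refine integral_mono (hin1 ω hω'.1).norm ((integrable_const _).add hI2) fun w => ?_
              refine (norm_inner_le_norm _ _).trans ?_
              nlinarith [sq_nonneg (‖gradient F (X ω)‖ - ‖g ((X ω, n ω), w)‖),
                sq_nonneg (‖gradient F (X ω)‖ + ‖g ((X ω, n ω), w)‖)]
          _ = ‖gradient F (X ω)‖ ^ 2 + ∫ w, ‖g ((X ω, n ω), w)‖ ^ 2 ∂Q.prod Z := by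
              rw [integral_add (integrable_const _) hI2]; simp
          _ ≤ _ := add_le_add le_rfl hω)
  rw [hW] at hsqE hinE hfibS hfibI
  set Γ : Ω → Vec d := fun ω => g ((X ω, n ω), (T ω, fun i => ζ i ω)) with hΓ
  have hΓm : Measurable Γ := hgmeas.comp (hXn.prodMk hWm)
  have hX'm : Measurable X' := hX.sub (hΓm.const_smul α)
  -- The two-sided bound serves twice: it makes `F (X' ω)` integrable, and its upper half is the
  -- descent inequality.
  have htaylor (ω : Ω) : |F (X' ω) - F (X ω) + α * inner ℝ (gradient F (X ω)) (Γ ω)|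
      ≤ LF / 2 * α ^ 2 * ‖Γ ω‖ ^ 2 := by
    have h1 := abs_sub_sub_inner_gradient_le hF1 hF.1 (X ω) (-(α • Γ ω))
    rw [inner_neg_right, real_inner_smul_right, sub_neg_eq_add, norm_neg, norm_smul, mul_pow,
      Real.norm_eq_abs, sq_abs, ← sub_eq_add_neg, ← mul_assoc] at h1
    exact h1
  have hrem : Integrable
      (fun ω => F (X' ω) - F (X ω) + α * inner ℝ (gradient F (X ω)) (Γ ω)) μ :=
    (hsqI.const_mul (LF / 2 * α ^ 2)).mono'
      (((hFm.comp hX'm).sub (hFm.comp hX)).add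
        (((hgm.comp hX).inner hΓm).const_mul α)).aestronglyMeasurable
      (Filter.Eventually.of_forall htaylor)
  have hF'I : Integrable (fun ω => F (X' ω)) μ := by
    refine ((hrem.add hFX).sub (hinI.const_mul α)).congr (Filter.Eventually.of_forall fun ω => ?_)
    simp only [Pi.add_apply, Pi.sub_apply]
    ring
  refine ⟨hF'I, ?_⟩
  have hα0 : 0 < α := by
    rw [hα, stepSize_eq, Omega₁]
    exact mul_pos (stepRatio_pos hd hN m) (by positivity)
  have hlow : ∫ ω, (‖gradient F (X ω)‖ ^ 2 / 4 - chiBar d N MF ν m) ∂μ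
      ≤ ∫ ω, (inner ℝ (gradient F (X ω)) (Γ ω) - LF * α / 2 * ‖Γ ω‖ ^ 2) ∂μ := by
    rw [integral_sub hinI (hsqI.const_mul _), integral_const_mul, hinE, hsqE,
      ← integral_const_mul, ← integral_sub hfibI (hfibS.const_mul _)]
    refine integral_mono_ae ((hG2.div_const 4).sub (integrable_const _))
      (hfibI.sub (hfibS.const_mul _)) ?_
    filter_upwards [hcond] with ω hω
    have hgL := memLp_centralFD hF2 hF.2 hν h8 γ (X ω)
    refine (hest (X ω)).trans ?_
    rw [integral_sub ((hgL.integrable one_le_two).const_inner _)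
      ((hgL.integrable_norm_pow two_ne_zero).const_mul _), integral_const_mul,
      integral_inner (hgL.integrable one_le_two)]
    simp only
    rw [integral_inner (hω.1.integrable one_le_two), hω.2.1]
    -- The definition of `Ω₁` is chosen for this: the factor `1 + θ²` from sampling is absorbed by
    -- the step size.
    have hratio : LF * α / 2 * (1 + θ ^ 2) = κ / 8 := by
      rw [hα, stepSize_eq, Omega₁, ← hκ]; field_simp; ring
    have h5 := mul_le_mul_of_nonneg_left hω.2.2 (by positivity : 0 ≤ LF * α / 2)
    rw [← mul_assoc, hratio] at h5
    linarith
  have hup : ∫ ω, F (X' ω) ∂μ ≤ ∫ ω, (F (X ω) - α *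
      (inner ℝ (gradient F (X ω)) (Γ ω) - LF * α / 2 * ‖Γ ω‖ ^ 2)) ∂μ := by
    refine integral_mono hF'I (hFX.sub ((hinI.sub (hsqI.const_mul _)).const_mul α)) fun ω => ?_
    have h6 := (abs_le.1 (htaylor ω)).2
    simp only
    linarith
  have hdI : Integrable (fun ω => inner ℝ (gradient F (X ω)) (Γ ω) - LF * α / 2 * ‖Γ ω‖ ^ 2) μ :=
    hinI.sub (hsqI.const_mul _)
  rw [integral_sub hFX (hdI.const_mul α), integral_const_mul] at hup
  rw [integral_sub (hG2.div_const 4) (integrable_const _), integral_div] at hlow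
  simp only [integral_const, probReal_univ, one_smul] at hlow
  have h7 := mul_le_mul_of_nonneg_left hlow hα0.le
  linarith

end Step

/-! ### Convergence -/

section Run

variable {d N : ℕ} {Ξ Ω : Type*} [MeasurableSpace Ξ] [mΩ : MeasurableSpace Ω] {P : Measure Ξ}
  [IsProbabilityMeasure P] {f : Vec d → Ξ → ℝ} {Lf Mf β₁ β₂ LF MF ν θ α : ℝ} {m : FDMethod}
  {x₀ : Vec d} {μ : Measure Ω} [IsProbabilityMeasure μ] {ℱ : Filtration ℕ mΩ}
  {T : ℕ → Ω → Fin N → Vec d} {ζ : ℕ → ℕ → Ω → Ξ} {size : ℕ → Ω → ℕ} {x : ℕ → Ω → Vec d}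

omit [IsProbabilityMeasure P] [IsProbabilityMeasure μ] in
lemma IsAdaptiveCFDRun.step_eq (h : IsAdaptiveCFDRun P f m ν θ α x₀ μ ℱ T ζ size x) (k : ℕ) :
    x (k + 1) = fun ω => x k ω - α •
      prefixEstimator f (scaling d N m) ν ((x k ω, size k ω), (T k ω, fun i => ζ k i ω)) :=
  funext (h.step k)

omit [IsProbabilityMeasure P] [IsProbabilityMeasure μ] in
-- Makes the pair of iterate and sample size `ℱ k`-measurable, hence independent of the directions
-- and samples drawn at step `k`.
lemma IsAdaptiveCFDRun.measurable_iterate (h : IsAdaptiveCFDRun P f m ν θ α x₀ μ ℱ T ζ size x)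
    (hf : Measurable (Function.uncurry f)) (k : ℕ) : Measurable[ℱ k] (x k) := by
  induction k with
  | zero =>
    have : x 0 = fun _ => x₀ := funext h.init
    rw [this]
    exact measurable_const
  | succ k ih =>
    rw [h.step_eq k]
    have h1 : Measurable[ℱ (k + 1)] (x k) := ih.mono (ℱ.mono k.le_succ) le_rfl
    have h2 : Measurable[ℱ (k + 1)] (size k) :=
      (h.measurable_size k).mono (ℱ.mono k.le_succ) le_rfl
    have h3 : Measurable[ℱ (k + 1)] fun ω i => ζ k i ω :=
      @measurable_pi_lambda Ω ℕ (fun _ => Ξ) (ℱ (k + 1)) _ _ (h.measurable_sample k)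
    have h4 : Measurable[ℱ (k + 1)] fun ω =>
        prefixEstimator f (scaling d N m) ν ((x k ω, size k ω), (T k ω, fun i => ζ k i ω)) :=
      (measurable_prefixEstimator hf _ _).comp
        ((h1.prodMk h2).prodMk ((h.measurable_dir k).prodMk h3))
    exact h1.sub (h4.const_smul α)

lemma IsAdaptiveCFDRun.expected_descent
    (h : IsAdaptiveCFDRun P f m ν θ (stepSize d N θ LF m) x₀ μ ℱ T ζ size x)
    (hd : 0 < d) (hN : 0 < N) (hsmooth : SmoothAssumption P f Lf Mf)
    (hvar : BoundedGradVariance P f β₁ β₂) (hLF : 0 < LF)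
    (hF : HasLipschitzGradHess (objective P f) LF MF) (hν : 0 < ν) (k : ℕ)
    (hk : Integrable (fun ω => objective P f (x k ω)) μ) :
    Integrable (fun ω => objective P f (x (k + 1) ω)) μ ∧
    ∫ ω, objective P f (x (k + 1) ω) ∂μ ≤ ∫ ω, objective P f (x k ω) ∂μ - stepSize d N θ LF m *
      ((∫ ω, ‖gradient (objective P f) (x k ω)‖ ^ 2 ∂μ) / 4 - chiBar d N MF ν m) := by
  have hxk := h.measurable_iterate hsmooth.measurable_uncurry k
  rw [h.step_eq k]
  have hpair : Measurable[ℱ k] fun ω => (x k ω, size k ω) := hxk.prodMk (h.measurable_size k)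
  have hind : IndepFun (fun ω => (x k ω, size k ω)) (fun ω => (T k ω, fun i => ζ k i ω)) μ := by
    rw [IndepFun_iff_Indep]
    exact (indep_of_indep_of_le_right (h.indep_past k) hpair.comap_le).symm
  exact _root_.expected_descent hd hN hsmooth hvar hLF hF m hν
    ((h.measurable_dir k).mono (ℱ.le _) le_rfl)
    (fun i => (h.measurable_sample k i).mono (ℱ.le _) le_rfl) (hxk.mono (ℱ.le _) le_rfl)
    ((h.measurable_size k).mono (ℱ.le _) le_rfl) (h.dir_law k) (h.sample_law k)
    (h.sample_indep k) (h.dir_indep_sample k) hind (h.size_pos k) (h.norm_condition k) hk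

lemma IsAdaptiveCFDRun.integrable_objective
    (h : IsAdaptiveCFDRun P f m ν θ (stepSize d N θ LF m) x₀ μ ℱ T ζ size x)
    (hd : 0 < d) (hN : 0 < N) (hsmooth : SmoothAssumption P f Lf Mf)
    (hvar : BoundedGradVariance P f β₁ β₂) (hLF : 0 < LF)
    (hF : HasLipschitzGradHess (objective P f) LF MF) (hν : 0 < ν) (k : ℕ) :
    Integrable (fun ω => objective P f (x k ω)) μ := by
  induction k with
  | zero => simp [h.init]
  | succ k ih => exact (h.expected_descent hd hN hsmooth hvar hLF hF hν k ih).1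

/-- The expected decreases telescope, and the last expected value is at least the infimum. -/
lemma IsAdaptiveCFDRun.sum_integral_le
    (h : IsAdaptiveCFDRun P f m ν θ (stepSize d N θ LF m) x₀ μ ℱ T ζ size x)
    (hd : 0 < d) (hN : 0 < N) (hsmooth : SmoothAssumption P f Lf Mf)
    (hvar : BoundedGradVariance P f β₁ β₂) (hLF : 0 < LF)
    (hF : HasLipschitzGradHess (objective P f) LF MF) (hν : 0 < ν) (K : ℕ) :
    stepSize d N θ LF m * ∑ k ∈ Finset.range K,
        ((∫ ω, ‖gradient (objective P f) (x k ω)‖ ^ 2 ∂μ) / 4 - chiBar d N MF ν m)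
      ≤ objective P f x₀ - ⨅ y, objective P f y := by
  have hint := h.integrable_objective hd hN hsmooth hvar hLF hF hν
  have h1 : stepSize d N θ LF m * ∑ k ∈ Finset.range K,
        ((∫ ω, ‖gradient (objective P f) (x k ω)‖ ^ 2 ∂μ) / 4 - chiBar d N MF ν m)
      ≤ objective P f x₀ - ∫ ω, objective P f (x K ω) ∂μ := by
    induction K with
    | zero => simp [h.init]
    | succ K ih =>
      have h2 := (h.expected_descent hd hN hsmooth hvar hLF hF hν K (hint K)).2
      rw [Finset.sum_range_succ, mul_add]
      linarith
  have h3 : ⨅ y, objective P f y ≤ ∫ ω, objective P f (x K ω) ∂μ := by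
    have := integral_mono (μ := μ) (integrable_const (⨅ y, objective P f y)) (hint K)
      fun ω => ciInf_le hsmooth.bddBelow (x K ω)
    simpa using this
  linarith

end Run

/-- Markov's inequality in the form of a confidence bound. -/
lemma one_sub_le_measureReal_le_div {Ω : Type*} [MeasurableSpace Ω] {μ : Measure Ω}
    [IsProbabilityMeasure μ] {Y : Ω → ℝ} (hm : Measurable Y) (hY : Integrable Y μ)
    (h0 : ∀ ω, 0 ≤ Y ω) {B p : ℝ} (hB : ∫ ω, Y ω ∂μ ≤ B) (hp : 0 < p) :
    1 - p ≤ μ.real {ω | Y ω ≤ B / p} := by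
  have hcompl : {ω | Y ω ≤ B / p} = {ω | B / p < Y ω}ᶜ := by ext ω; simp
  rw [hcompl, probReal_compl_eq_one_sub (measurableSet_lt measurable_const hm)]
  suffices μ.real {ω | B / p < Y ω} ≤ p by linarith
  have hI0 : 0 ≤ ∫ ω, Y ω ∂μ := integral_nonneg h0
  -- For `B = 0` the threshold vanishes and Markov's inequality is empty; then `Y` is zero almost
  -- everywhere.
  rcases (hI0.trans hB).eq_or_lt with hB0 | hB0
  · have hI : ∫ ω, Y ω ∂μ = 0 := le_antisymm (by linarith) hI0
    have hae : Y =ᵐ[μ] 0 := (integral_eq_zero_iff_of_nonneg h0 hY).1 hI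
    have hz : μ {ω | B / p < Y ω} = 0 := by
      refine measure_eq_zero_iff_ae_notMem.2 (hae.mono fun ω hω => ?_)
      simp [hω, ← hB0]
    simp [measureReal_def, hz, hp.le]
  · have h1 := mul_meas_ge_le_integral_of_nonneg (Filter.Eventually.of_forall h0) hY (B / p)
    have h2 : μ.real {ω | B / p < Y ω} ≤ μ.real {ω | B / p ≤ Y ω} :=
      measureReal_mono fun ω (hω : B / p < Y ω) => hω.le
    have h3 : B / p * μ.real {ω | B / p < Y ω} ≤ B / p * p := by
      rw [div_mul_cancel₀ B hp.ne']
      exact (mul_le_mul_of_nonneg_left h2 (by positivity)).trans (h1.trans hB)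
    exact le_of_mul_le_mul_left h3 (by positivity)

theorem theorem1 {d N : ℕ} (hd : 0 < d) (hN : 0 < N) {Ξ : Type*} [MeasurableSpace Ξ]
    (P : Measure Ξ) [IsProbabilityMeasure P] (f : Vec d → Ξ → ℝ) (Lf Mf β₁ β₂ : ℝ)
    (hsmooth : SmoothAssumption P f Lf Mf) (hvar : BoundedGradVariance P f β₁ β₂) :
    HasLipschitzGradHess (objective P f) Lf Mf ∧
    ∀ (LF MF : ℝ), 0 < LF → HasLipschitzGradHess (objective P f) LF MF →
    ∀ (m : FDMethod) (ν θ : ℝ), 0 < ν → 0 < θ →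
    ∀ (x₀ : Vec d) {Ω : Type*} [mΩ : MeasurableSpace Ω] (μ : Measure Ω) [IsProbabilityMeasure μ]
      (ℱ : Filtration ℕ mΩ) (T : ℕ → Ω → Fin N → Vec d) (ζ : ℕ → ℕ → Ω → Ξ)
      (size : ℕ → Ω → ℕ) (x : ℕ → Ω → Vec d),
      IsAdaptiveCFDRun P f m ν θ (stepSize d N θ LF m) x₀ μ ℱ T ζ size x →
      (∀ k, Integrable (fun ω => ‖gradient (objective P f) (x k ω)‖ ^ 2) μ) ∧
      ∀ (K : ℕ) (hK : (Finset.range K).Nonempty),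
        ((Finset.range K).inf' hK fun k => ∫ ω, ‖gradient (objective P f) (x k ω)‖ ^ 2 ∂μ)
            ≤ 4 * (objective P f x₀ - ⨅ y, objective P f y) / (K * stepSize d N θ LF m)
              + 4 * chiBar d N MF ν m ∧
        ∀ p : ℝ, 0 < p → p ≤ 1 →
          1 - p ≤ μ.real {ω |
            ((Finset.range K).inf' hK fun k => ‖gradient (objective P f) (x k ω)‖ ^ 2)
              ≤ 4 * (objective P f x₀ - ⨅ y, objective P f y) / (K * stepSize d N θ LF m * p)
                + 4 * chiBar d N MF ν m / p} := by
  refine ⟨hasLipschitzGradHess_objective hsmooth, ?_⟩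
  intro LF MF hLF hF m ν θ hν hθ x₀ Ω mΩ μ hμ ℱ T ζ size x h
  have hGint (k : ℕ) : Integrable (fun ω => ‖gradient (objective P f) (x k ω)‖ ^ 2) μ :=
    integrable_norm_sq_gradient_comp hsmooth hLF hF
      ((h.measurable_iterate hsmooth.measurable_uncurry k).mono (ℱ.le _) le_rfl)
      (h.integrable_objective hd hN hsmooth hvar hLF hF hν k)
  refine ⟨hGint, fun K hK => ?_⟩
  have hK0 : (0 : ℝ) < K := by
    have : K ≠ 0 := by simpa using hK
    exact_mod_cast Nat.pos_of_ne_zero this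
  set α := stepSize d N θ LF m with hα
  have hα0 : 0 < α := by
    rw [hα, stepSize_eq, Omega₁]
    exact mul_pos (stepRatio_pos hd hN m) (by positivity)
  set χ := chiBar d N MF ν m
  set Δ := objective P f x₀ - ⨅ y, objective P f y
  have hsum := h.sum_integral_le hd hN hsmooth hvar hLF hF hν K
  have hmin : ((Finset.range K).inf' hK fun k => ∫ ω, ‖gradient (objective P f) (x k ω)‖ ^ 2 ∂μ)
      ≤ 4 * Δ / (K * α) + 4 * χ := by
    set I := (Finset.range K).inf' hK fun k => ∫ ω, ‖gradient (objective P f) (x k ω)‖ ^ 2 ∂μ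
    have h0 (k : ℕ) (hk : k ∈ Finset.range K) : I / 4 - χ ≤
        (∫ ω, ‖gradient (objective P f) (x k ω)‖ ^ 2 ∂μ) / 4 - χ := by
      have : I ≤ ∫ ω, ‖gradient (objective P f) (x k ω)‖ ^ 2 ∂μ := Finset.inf'_le _ hk
      linarith
    -- The minimum is at most each of the `K` terms, so `K` copies of it are bounded by the
    -- telescoped sum.
    have h1 : K * (I / 4 - χ) ≤ ∑ k ∈ Finset.range K,
        ((∫ ω, ‖gradient (objective P f) (x k ω)‖ ^ 2 ∂μ) / 4 - χ) := by
      simpa using Finset.card_nsmul_le_sum _ _ _ h0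
    have h2 := (mul_le_mul_of_nonneg_left h1 hα0.le).trans hsum
    have h3 : I / 4 - χ ≤ Δ / (K * α) := by
      rw [le_div_iff₀ (by positivity)]
      linarith
    rw [mul_div_assoc]
    linarith
  refine ⟨hmin, fun p hp _ => ?_⟩
  have hYm (k : ℕ) : Measurable fun ω => ‖gradient (objective P f) (x k ω)‖ ^ 2 :=
    ((contDiff_gradient hsmooth.contDiff_objective).continuous.measurable.comp
      ((h.measurable_iterate hsmooth.measurable_uncurry k).mono (ℱ.le _) le_rfl)).norm.pow_const 2
  set Y : Ω → ℝ := fun ω =>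
    (Finset.range K).inf' hK fun k => ‖gradient (objective P f) (x k ω)‖ ^ 2 with hY
  have hYmeas : Measurable Y := by
    have e : Y = (Finset.range K).inf' hK
        fun k ω => ‖gradient (objective P f) (x k ω)‖ ^ 2 := by
      ext ω; simp [hY, Finset.inf'_apply]
    rw [e]
    exact Finset.inf'_induction hK _ (fun _ h₁ _ h₂ => h₁.inf h₂) fun k _ => hYm k
  have hY0 (ω : Ω) : 0 ≤ Y ω := Finset.le_inf' hK _ fun k _ => sq_nonneg _
  have hYle (k : ℕ) (hk : k ∈ Finset.range K) (ω : Ω) :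
      Y ω ≤ ‖gradient (objective P f) (x k ω)‖ ^ 2 :=
    Finset.inf'_le (fun k => ‖gradient (objective P f) (x k ω)‖ ^ 2) hk
  have hYint : Integrable Y μ := by
    obtain ⟨k, hk⟩ := hK
    refine (hGint k).mono' hYmeas.aestronglyMeasurable (Filter.Eventually.of_forall fun ω => ?_)
    rw [Real.norm_eq_abs, abs_of_nonneg (hY0 ω)]
    exact hYle k hk ω
  -- The expectation of the minimum is at most the minimum of the expectations, so Markov's
  -- inequality applied to the minimum gives the confidence bound.
  have hYE : ∫ ω, Y ω ∂μ ≤ 4 * Δ / (K * α) + 4 * χ :=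
    (Finset.le_inf' hK _ fun k hk => integral_mono hYint (hGint k) (hYle k hk)).trans hmin
  have hfin := one_sub_le_measureReal_le_div hYmeas hYint hY0 hYE hp
  have e : (4 * Δ / (K * α) + 4 * χ) / p = 4 * Δ / (K * α * p) + 4 * χ / p := by
    rw [add_div, div_div]
  rw [e] at hfin
  exact hfin
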